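/- A bisimplicial set is a functor $X\colon \Delta^{\mathrm{op}}\times\Delta^{\mathrm{op}}\to \mathrm{Set}$; write $X_{m,n}=X([m],[n])$, let $X_{m*}$ denote its $m$-th column, the simplicial set $(X_{m*})_n=X_{m,n}$, and let $dX$ denote its diagonal, $(dX)_n=X_{n,n}$. For simplicial sets $K,L$ let $K\,\Box\,L$ be the bisimplicial set $(K\,\Box\,L)_{m,n}=K_m\times L_n$. A map of simplicial sets is left anodyne if it belongs to the saturated class of monomorphisms (the smallest class of monomorphisms containing the isomorphisms and closed under pushouts, small coproducts, transfinite compositions and retracts) generated by the horn inclusions $\Lambda^k[n]\subset\Delta[n]$, $n\ge 1$, $0\le k<n$. It is a left fibration if it has the right lifting property against all left anodyne maps; a trivial Kan fibration if it has the right lifting property against the inclusions $\partial\Delta[n]\subset\Delta[n]$, $n\ge 0$; and right cofinal if it factors as a left anodyne map followed by a trivial Kan fibration. A map $p\colon X\to Y$ of bisimplicial sets is a horizontal Reedy left fibration if it has the right lifting property against all inclusions $$\partial\Delta[m]\,\Box\,\Delta[n]\,\cup\,\Delta[m]\,\Box\,\Lambda^k[n]\ \subset\ \Delta[m]\,\Box\,\Delta[n],\qquad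 m\ge 0,\ n\ge 1,\ 0\le k<n.$$ It is strong if in addition, for every $n\ge 0$, the map $X_{n*}\to X_{0*}\times_{Y_{0*}}Y_{n*}$ induced by $p$ and by the initial vertex $0\colon[0]\to[n]$ is a trivial Kan fibration. Theorem. (1) If $p\colon X\to Y$ is a strong horizontal Reedy left fibration of bisimplicial sets, then its diagonal $dp\colon dX\to dY$ is a left fibration of simplicial sets. (2) If $f\colon X\to Y$ is a map of bisimplicial sets which is column-wise right cofinal, that is, $f_m\colon X_{m*}\to Y_{m*}$ is right cofinal for every $m\ge 0$, then its diagonal $df\colon dX\to dY$ is a right cofinal map of simplicial sets. -/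

import Mathlib

open CategoryTheory Simplicial Opposite

universe u

/-! ### Saturated classes of monomorphisms, left anodyne maps and left fibrations -/

/-- A saturated class of monomorphisms in a category `C`: a class of monomorphisms which contains
the isomorphisms and is closed under pushouts, small coproducts, transfinite compositions and
retracts. -/
structure IsSaturatedClassOfMono {C : Type (u + 1)} [Category.{u} C]
    (W : MorphismProperty C) : Prop where
  le_monomorphisms : W ≤ MorphismProperty.monomorphisms C
  isomorphisms_le : MorphismProperty.isomorphisms C ≤ W
  cobaseChange : W.IsStableUnderCobaseChange
  coproducts : MorphismProperty.IsStableUnderCoproducts.{u} W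
  transfiniteComposition : MorphismProperty.IsStableUnderTransfiniteComposition.{u} W
  retracts : W.IsStableUnderRetracts

namespace SSet

/-- The horn inclusions `Λ[n, k] ⟶ Δ[n]` for `n ≥ 1` and `0 ≤ k < n`. -/
inductive leftHornInclusions : MorphismProperty SSet.{u} where
  | intro {n : ℕ} (k : Fin (n + 1)) (hn : 1 ≤ n) (hk : k < Fin.last n) :
    leftHornInclusions Λ[n, k].ι

/-- The left anodyne maps: the saturated class of monomorphisms generated by the horn inclusions
`Λ[n, k] ⟶ Δ[n]` for `n ≥ 1` and `0 ≤ k < n`. -/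
def leftAnodyneMaps : MorphismProperty SSet.{u} := fun _ _ i ↦
  ∀ W : MorphismProperty SSet.{u}, IsSaturatedClassOfMono W → leftHornInclusions ≤ W → W i

/-- The left fibrations: the maps with the right lifting property against all left anodyne
maps. -/
def leftFibrations : MorphismProperty SSet.{u} := leftAnodyneMaps.rlp

/-- The trivial Kan fibrations: the maps with the right lifting property against the boundary
inclusions `∂Δ[n] ⟶ Δ[n]` for `n ≥ 0`. -/
def trivialKanFibrations : MorphismProperty SSet.{u} := modelCategoryQuillen.I.rlp

/-- The right cofinal maps: those which factor as a left anodyne map followed by a trivial Kan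
fibration. -/
def rightCofinalMaps : MorphismProperty SSet.{u} := fun A B v ↦
  ∃ (B' : SSet.{u}) (i : A ⟶ B') (p : B' ⟶ B),
    leftAnodyneMaps i ∧ trivialKanFibrations p ∧ i ≫ p = v

end SSet

/-! ### Bisimplicial sets -/

/-- Bisimplicial sets: `X.obj (op ⦋m⦌, op ⦋n⦌)` is the set `X_{m,n}`, with horizontal degree `m`
and vertical degree `n`. -/
abbrev BiSSet : Type (u + 1) := (SimplexCategoryᵒᵖ × SimplexCategoryᵒᵖ) ⥤ Type u

namespace BiSSet

/-- The diagonal functor, `(dX)_n = X_{n,n}`. -/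
def diagonal : BiSSet.{u} ⥤ SSet.{u} :=
  (Functor.whiskeringLeft _ _ _).obj (Functor.diag SimplexCategoryᵒᵖ)

/-- The `m`-th column functor, `(X_{m*})_n = X_{m,n}`. -/
def column (m : ℕ) : BiSSet.{u} ⥤ SSet.{u} :=
  (Functor.whiskeringLeft _ _ _).obj (Prod.sectR (op ⦋m⦌) SimplexCategoryᵒᵖ)

/-- The map `X_{n*} ⟶ X_{m*}` induced by `α : ⦋m⦌ ⟶ ⦋n⦌`, naturally in `X`. -/
def columnMap {m n : ℕ} (α : ⦋m⦌ ⟶ ⦋n⦌) : column.{u} n ⟶ column.{u} m :=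
  (Functor.whiskeringLeft _ _ _).map
    { app b := Prod.mkHom α.op (𝟙 b)
      naturality _ _ _ := Prod.ext ((Category.id_comp _).trans (Category.comp_id _).symm)
        ((Category.comp_id _).trans (Category.id_comp _).symm) }

/-- The box product `K □ L`, with `(K □ L)_{m,n} = K_m × L_n`. -/
def box (K L : SSet.{u}) : BiSSet.{u} where
  obj a := K.obj a.1 × L.obj a.2
  map f := ↾fun x ↦ (K.map f.1 x.1, L.map f.2 x.2)

/-- The box product `A □ B ⊆ K □ L` of subcomplexes `A ⊆ K` and `B ⊆ L`. -/
def boxSub {K L : SSet.{u}} (A : K.Subcomplex) (B : L.Subcomplex) :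
    Subfunctor (box K L) where
  obj a := {x | x.1 ∈ A.obj a.1 ∧ x.2 ∈ B.obj a.2}
  map f _ hx := ⟨A.map f.1 hx.1, B.map f.2 hx.2⟩

/-- The bisimplicial subset `A □ L ∪ K □ B` of `K □ L`. -/
def boxUnion {K L : SSet.{u}} (A : K.Subcomplex) (B : L.Subcomplex) :
    Subfunctor (box K L) :=
  boxSub A ⊤ ⊔ boxSub ⊤ B

/-- The inclusions `∂Δ[m] □ Δ[n] ∪ Δ[m] □ Λ[n, k] ⟶ Δ[m] □ Δ[n]` for `m ≥ 0`, `n ≥ 1` and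
`0 ≤ k < n`. -/
inductive horizontalLeftHornInclusions : MorphismProperty BiSSet.{u} where
  | intro (m : ℕ) {n : ℕ} (k : Fin (n + 1)) (hn : 1 ≤ n) (hk : k < Fin.last n) :
    horizontalLeftHornInclusions (boxUnion ∂Δ[m] Λ[n, k]).ι

/-- The horizontal Reedy left fibrations. -/
def horizontalReedyLeftFibrations : MorphismProperty BiSSet.{u} :=
  horizontalLeftHornInclusions.rlp

/-- The map `X_{n*} ⟶ X_{0*} ×_{Y_{0*}} Y_{n*}` whose components are induced by the initial vertex
`0 : ⦋0⦌ ⟶ ⦋n⦌` and by `p : X ⟶ Y`. -/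
noncomputable def initialVertexMap {X Y : BiSSet.{u}} (p : X ⟶ Y) (n : ℕ) :
    (column n).obj X ⟶ Limits.pullback ((column 0).map p)
      ((columnMap (SimplexCategory.const ⦋0⦌ ⦋n⦌ 0)).app Y) :=
  Limits.pullback.lift ((columnMap (SimplexCategory.const ⦋0⦌ ⦋n⦌ 0)).app X)
    ((column n).map p) ((columnMap _).naturality p).symm

/-- A horizontal Reedy left fibration `p : X ⟶ Y` is strong if
`X_{n*} ⟶ X_{0*} ×_{Y_{0*}} Y_{n*}` is a trivial Kan fibration for all `n ≥ 0`. -/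
structure IsStrongHorizontalReedyLeftFibration {X Y : BiSSet.{u}} (p : X ⟶ Y) : Prop where
  horizontalReedyLeftFibration : horizontalReedyLeftFibrations p
  trivialKanFibration (n : ℕ) : SSet.trivialKanFibrations (initialVertexMap p n)

/-- A map of bisimplicial sets is column-wise right cofinal if each `f_m : X_{m*} ⟶ Y_{m*}` is
right cofinal. -/
def IsColumnwiseRightCofinal {X Y : BiSSet.{u}} (f : X ⟶ Y) : Prop :=
  ∀ m : ℕ, SSet.rightCofinalMaps ((column m).map f)

end BiSSet

/-!
The proof rests on the box product `K □ L` and on its right adjoints. For a map `p` of bisimplicial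
sets, let `boxTrivial p` be the class of maps `i` of simplicial sets such that `p` has the right
lifting property against the pushout-product, for `□`, of `i` and any monomorphism; equivalently,
the pullback-hom of `i` and `p` is a trivial Kan fibration. When `p` is a horizontal Reedy left
fibration, the pullback-homs of monomorphisms with `p` are left fibrations, and this class has right
cancellation among monomorphisms (`BiSSet.boxTrivial_of_precomp`), because a left fibration `r` is a
trivial Kan fibration as soon as `q` and `r ≫ q` are
(`SSet.trivialKanFibrations_of_postcomp`).

Lifting properties of the diagonal of `p` are deduced from lifting properties of `p` as follows. For
a set `V` of vertices of `Δ[n]`, a map to `dX` from the generalized horn of `V`, which consists of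
the simplices that miss an element of `V`, extends to a map to `X` from the bisimplicial subset
`BiSSet.diagonalHorn V` of `Δ[n] □ Δ[n]`, which consists of the pairs of simplices whose sets of
vertices `S` and `T` satisfy `¬ V ⊆ S ∪ T`. Hence it suffices to lift maps along the inclusion of
`diagonalHorn V`. This inclusion is filtered by the sets of vertices of the components, one set at a
time (`CategoryTheory.Subfunctor.homOfLe_sup_suppIn`), and the pieces that are attached are
pushout-products of generalized horns and boundaries.

* For `V = {k}ᶜ` with `k < n` and `p` strong, the pairs such that `n ∉ T` are attached first, along
  pushout-products of the generalized horns of `V \ T` and of boundaries. These generalized horns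
  belong to `boxTrivial p`: this class contains the inclusions of the initial vertices as `p` is
  strong, and they are generated by these under pushouts, compositions and right cancellation,
  since `n ∈ V \ T` is preceded by `k ∉ V \ T`. The remaining pairs are attached along
  pushout-products of boundaries and of the generalized horns of `insert n (V \ S)`, which are left
  anodyne. This shows that `dp` is a left fibration (`BiSSet.leftFibrations_diagonal_map`).
* For `V` the set of all vertices, if `boxTrivial p` contains all monomorphisms, then `dp` is a
  trivial Kan fibration (`BiSSet.trivialKanFibrations_diagonal_map`).

For a column-wise right cofinal map `f`, the small object argument gives a factorization `f = i ≫ p`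
where `p` is a horizontal Reedy left fibration, and the columns and the diagonal of `i` are left
anodyne. The columns of `p` are left fibrations whose compositions with left anodyne maps are right
cofinal, so they are trivial Kan fibrations (`SSet.trivialKanFibrations_of_rightCofinalMaps_comp`).
This means that the maps `∅ ⟶ Δ[m]` belong to `boxTrivial p`, and then so do all monomorphisms, by
right cancellation. It follows that `dp` is a trivial Kan fibration, and `df = di ≫ dp` is right
cofinal.
-/

/-! ### Filtering a functor to types by supports -/

namespace CategoryTheory.Subfunctor

universe w v v' u'

variable {C : Type u'} [Category.{v'} C] {F P : C ⥤ Type w}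

lemma isPushout_of_bicartSq {A₁ A₂ A₃ A₄ : Subfunctor F} (sq : Lattice.BicartSq A₁ A₂ A₃ A₄) :
    IsPushout (homOfLe sq.le₁₂) (homOfLe sq.le₁₃) (homOfLe sq.le₂₄) (homOfLe sq.le₃₄) where
  w := rfl
  isColimit' :=
    ⟨Limits.evaluationJointlyReflectsColimits _
      (fun n ↦ (Limits.PushoutCocone.isColimitMapCoconeEquiv _ _).2 (by
        have h : Lattice.BicartSq (A₁.obj n) (A₂.obj n) (A₃.obj n) (A₄.obj n) :=
          { sup_eq := by
              rw [← sq.sup_eq]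
              rfl
            inf_eq := by
              rw [← sq.inf_eq]
              rfl }
        exact (Limits.Types.isPushout_of_bicartSq h).isColimit))⟩

variable (W : MorphismProperty (C ⥤ Type w))

lemma homOfLe_of_eq [W.IsMultiplicative] [W.RespectsIso] {A B : Subfunctor F} (h : A = B) :
    W (homOfLe h.le) := by
  subst h
  exact W.id_mem _

/-- The inclusion of the preimage of `A` under a monomorphism `g` is isomorphic to the inclusion
of `A ⊓ range g` in `range g`. -/
noncomputable def preimageArrowIso (A : Subfunctor F) (g : P ⟶ F) [Mono g] :
    Arrow.mk (A.preimage g).ι ≅ Arrow.mk (homOfLe (inf_le_right : A ⊓ range g ≤ range g)) :=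
  have hg (n : C) : Function.Injective (g.app n) := by
    rw [← mono_iff_injective]
    infer_instance
  Arrow.isoMk
    (NatIso.ofComponents (fun n ↦ Equiv.toIso (Equiv.ofBijective
      (fun x ↦ (⟨g.app n x.1, x.2, x.1, rfl⟩ : (A ⊓ range g).toFunctor.obj n))
      ⟨fun x y h ↦ Subtype.ext (hg n (congr_arg Subtype.val h)), by
        rintro ⟨_, hx, x, rfl⟩
        exact ⟨⟨x, hx⟩, rfl⟩⟩)) (fun f ↦ by
          ext x
          apply Subtype.ext
          exact NatTrans.naturality_apply g f x.1))
    (asIso (toRange g)) (by ext; rfl)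

/-- Attaching `range g` to `A` is a cobase change of the inclusion of the preimage of `A`. -/
lemma homOfLe_sup_range [W.IsStableUnderCobaseChange] (A : Subfunctor F)
    (g : P ⟶ F) [Mono g] (h : W (A.preimage g).ι) :
    W (homOfLe (le_sup_left : A ≤ A ⊔ range g)) :=
  MorphismProperty.of_isPushout
    (isPushout_of_bicartSq (A₁ := A ⊓ range g) (A₂ := A) (A₃ := range g) (A₄ := A ⊔ range g)
      ⟨rfl, rfl⟩) ((W.arrow_mk_iso_iff (preimageArrowIso A g)).1 h)

section Support

variable {α : Type*} (supp : ∀ ⦃U : C⦄, F.obj U → Finset α)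
  (hsupp : ∀ ⦃U V : C⦄ (f : U ⟶ V) (x : F.obj U), supp (F.map f x) ⊆ supp x)

/-- The elements whose support belongs to a lower set `𝒰` of finite sets. -/
@[simps]
def suppIn (𝒰 : LowerSet (Finset α)) : Subfunctor F where
  obj _ := {x | supp x ∈ 𝒰}
  map f x hx := 𝒰.lower (hsupp f x) hx

/-- A subfunctor `D` is enlarged to contain all the elements whose support belongs to `𝒰` by
attaching, one support `T ∈ 𝒰` at a time, the elements supported in `T`. -/
lemma homOfLe_sup_suppIn [Finite α] [W.IsMultiplicative] [W.IsStableUnderCobaseChange]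
    (hne : ∀ ⦃U : C⦄ (x : F.obj U), (supp x).Nonempty) (D : Subfunctor F)
    (𝒰 : LowerSet (Finset α))
    (h : ∀ T ∈ 𝒰, T.Nonempty → ∃ (P : C ⥤ Type w) (g : P ⟶ F), Mono g ∧
      range g = suppIn supp hsupp (LowerSet.Iic T) ∧
      W ((D ⊔ suppIn supp hsupp (LowerSet.Iio T)).preimage g).ι) :
    W (homOfLe (le_sup_left : D ≤ D ⊔ suppIn supp hsupp 𝒰)) := by
  classical
  induction 𝒰 using WellFoundedLT.induction with
  | ind 𝒰 ih =>
    obtain rfl | ⟨S, hS⟩ := (𝒰 : Set (Finset α)).eq_empty_or_nonempty.imp_left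
      (fun h ↦ SetLike.coe_injective (h.trans LowerSet.coe_bot.symm))
    · refine homOfLe_of_eq W (le_antisymm le_sup_left (sup_le le_rfl ?_))
      rintro U x ⟨⟩
    · obtain ⟨T, hT⟩ := (Set.toFinite (𝒰 : Set (Finset α))).exists_maximal ⟨S, hS⟩
      have hlt : 𝒰.erase T < 𝒰 := LowerSet.erase_lt.2 hT.1
      have hmem {S : Finset α} : S ∈ 𝒰.erase T ↔ S ∈ 𝒰 ∧ S ≠ T := by
        refine ⟨fun h ↦ ⟨hlt.le h, ?_⟩, fun ⟨h₁, h₂⟩ ↦ ⟨h₁, fun h₃ ↦ ?_⟩⟩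
        · rintro rfl
          exact h.2 (UpperSet.mem_Ici_iff.2 le_rfl)
        · exact h₂ (le_antisymm (hT.2 h₁ h₃) h₃)
      have h₁ := ih _ hlt (fun S hS ↦ h S (hlt.le hS))
      have hsup : D ⊔ suppIn supp hsupp (𝒰.erase T) ⊔ suppIn supp hsupp (LowerSet.Iic T) =
          D ⊔ suppIn supp hsupp 𝒰 := by
        refine le_antisymm (sup_le (sup_le_sup le_rfl fun U x hx ↦ hlt.le hx)
          (le_sup_of_le_right fun U x hx ↦ 𝒰.lower hx hT.1)) (sup_le (le_sup_of_le_left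
            le_sup_left) fun U x hx ↦ ?_)
        by_cases hx' : supp x = T
        · exact Or.inr hx'.le
        · exact Or.inl (Or.inr (hmem.2 ⟨hx, hx'⟩))
      have h₂ : W (homOfLe (le_sup_left : D ⊔ suppIn supp hsupp (𝒰.erase T) ≤
          D ⊔ suppIn supp hsupp (𝒰.erase T) ⊔ suppIn supp hsupp (LowerSet.Iic T))) := by
        by_cases hTne : T.Nonempty
        · obtain ⟨P, g, _, hg, hW⟩ := h T hT.1 hTne
          rw [← hg]
          apply homOfLe_sup_range
          convert hW using 2
          all_goals
          · ext U x
            have hx : supp (g.app U x) ⊆ T := by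
              have : g.app U x ∈ (range g).obj U := ⟨x, rfl⟩
              rw [hg] at this
              exact this
            refine or_congr_right ⟨fun h ↦ ?_, fun h ↦ ?_⟩
            · exact lt_of_le_of_ne hx (hmem.1 h).2
            · exact hmem.2 ⟨𝒰.lower hx hT.1, ne_of_lt h⟩
        · refine homOfLe_of_eq W (le_antisymm le_sup_left (sup_le le_rfl fun U x hx ↦ ?_))
          exact (hTne ((hne x).mono hx)).elim
      have h₃ := W.comp_mem _ _ (W.comp_mem _ _ h₁ h₂) (homOfLe_of_eq W hsup)
      exact h₃

end Support

end CategoryTheory.Subfunctor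

namespace SSet

open MorphismProperty Limits MonoidalCategory MonoidalClosed

/-! ### Left anodyne maps and the small object argument -/

lemma leftHornInclusions_eq_iSup : leftHornInclusions.{u} =
    ⨆ n : ℕ, .ofHoms (fun k : {k : Fin (n + 2) // k < Fin.last (n + 1)} ↦ Λ[n + 1, k.1].ι) := by
  ext X Y f
  simp only [iSup_iff]
  refine ⟨fun h ↦ ?_, fun h ↦ ?_⟩
  · obtain @⟨n, k, hn, hk⟩ := h
    obtain _ | n := n
    · lia
    · exact ⟨n, ⟨(⟨k, hk⟩ : {k : Fin (n + 2) // k < Fin.last (n + 1)})⟩⟩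
  · obtain ⟨n, ⟨k, hk⟩⟩ := h
    exact .intro k (by lia) hk

attribute [local instance] Cardinal.fact_isRegular_aleph0 Cardinal.orderBotAleph0OrdToType

instance : MorphismProperty.IsSmall.{u} leftHornInclusions.{u} := by
  rw [leftHornInclusions_eq_iSup]
  have (n : ℕ) : MorphismProperty.IsSmall.{u} (MorphismProperty.ofHoms.{u}
      fun k : {k : Fin (n + 2) // k < Fin.last (n + 1)} ↦ Λ[n + 1, k.1].ι) :=
    isSmall_ofHoms ..
  exact isSmall_iSup _

instance : IsCardinalForSmallObjectArgument leftHornInclusions.{u} Cardinal.aleph0.{u} where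
  preservesColimit {A B X Y} i hi f hf := by
    have : IsFinitelyPresentable.{u} A := by
      obtain ⟨_, _, _⟩ := hi
      infer_instance
    infer_instance

instance : HasSmallObjectArgument.{u} leftHornInclusions.{u} where
  exists_cardinal := ⟨.aleph0, inferInstance, inferInstance, inferInstance⟩

lemma leftHornInclusions_le_monomorphisms :
    leftHornInclusions.{u} ≤ monomorphisms SSet.{u} := by
  rintro _ _ _ ⟨_, _, _⟩
  exact monomorphisms.infer_property _

lemma isSaturatedClassOfMono_llp_rlp_inf {W : MorphismProperty SSet.{u}} :
    IsSaturatedClassOfMono (W.rlp.llp ⊓ monomorphisms SSet.{u}) where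
  le_monomorphisms := inf_le_right
  isomorphisms_le _ _ f hf := by
    have : IsIso f := hf
    exact ⟨MorphismProperty.of_isIso _ _, monomorphisms.infer_property _⟩
  cobaseChange := inferInstance
  coproducts := ⟨fun J ↦ by
    refine (isStableUnderColimitsOfShape_iff_colimitsOfShape_le _ _).2 ?_
    exact le_inf ((colimitsOfShape_monotone inf_le_left _).trans colimitsOfShape_le)
      ((colimitsOfShape_monotone inf_le_right _).trans colimitsOfShape_le)⟩
  transfiniteComposition := ⟨fun J _ _ _ _ ↦ by
    rw [isStableUnderTransfiniteCompositionOfShape_iff]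
    exact le_inf ((transfiniteCompositionsOfShape_monotone J inf_le_left).trans
        (transfiniteCompositionsOfShape_le _ _))
      ((transfiniteCompositionsOfShape_monotone J inf_le_right).trans
        (transfiniteCompositionsOfShape_le _ _))⟩
  retracts := inferInstance

/-- By the small object argument, the left anodyne maps are the maps with the left lifting property
against all maps with the right lifting property against the left horn inclusions. -/
lemma leftAnodyneMaps_eq_llp_rlp : leftAnodyneMaps.{u} = leftHornInclusions.rlp.llp := by
  apply le_antisymm
  · intro A B i hi
    exact (hi _ isSaturatedClassOfMono_llp_rlp_inf
      (le_inf (le_llp_rlp _) leftHornInclusions_le_monomorphisms)).1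
  · rw [llp_rlp_of_hasSmallObjectArgument]
    intro A B i hi W hW hW'
    have := hW.cobaseChange
    have := hW.coproducts
    have := hW.transfiniteComposition
    have := hW.retracts
    refine (MorphismProperty.retracts_le W) _ (MorphismProperty.retracts_monotone ?_ _ hi)
    simp only [transfiniteCompositions_le_iff, pushouts_le_iff, coproducts_le_iff]
    exact hW'

lemma leftAnodyneMaps_le_monomorphisms : leftAnodyneMaps.{u} ≤ monomorphisms SSet.{u} :=
  fun _ _ _ hi ↦ (hi _ isSaturatedClassOfMono_llp_rlp_inf
    (le_inf (le_llp_rlp _) leftHornInclusions_le_monomorphisms)).2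

lemma leftFibrations_eq_rlp : leftFibrations.{u} = leftHornInclusions.rlp := by
  rw [leftFibrations, leftAnodyneMaps_eq_llp_rlp, rlp_llp_rlp]

instance : leftAnodyneMaps.{u}.IsMultiplicative := by
  rw [leftAnodyneMaps_eq_llp_rlp]; infer_instance

instance : leftAnodyneMaps.{u}.IsStableUnderCobaseChange := by
  rw [leftAnodyneMaps_eq_llp_rlp]; infer_instance

lemma leftAnodyneMaps_horn_ι {n : ℕ} (k : Fin (n + 1)) (hn : 1 ≤ n) (hk : k < Fin.last n) :
    leftAnodyneMaps.{u} Λ[n, k].ι :=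
  fun _ _ hW ↦ hW _ (.intro k hn hk)

lemma trivialKanFibrations_eq_rlp :
    trivialKanFibrations.{u} = (monomorphisms SSet.{u}).rlp :=
  rlp_monomorphisms.symm

lemma trivialKanFibrations_le_leftFibrations :
    trivialKanFibrations.{u} ≤ leftFibrations := by
  rw [trivialKanFibrations_eq_rlp]
  exact antitone_rlp leftAnodyneMaps_le_monomorphisms

/-! ### Left anodyne maps and pushout-products -/

/-- If no type (I) simplex of a pairing core is paired with its last face, then the relative cell
complex of the associated pairing attaches no outer horn `Λ[n, n]`. -/
lemma Subcomplex.PairingCore.index_ne_last {X : SSet.{u}} {A : X.Subcomplex} (h : A.PairingCore)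
    [h.IsProper] (hl : ∀ s, h.index s ≠ Fin.last _) (x : h.pairing.II) {d : ℕ}
    (hd : x.1.dim = d) : (h.pairing.isUniquelyCodimOneFace x).index hd ≠ Fin.last _ := by
  obtain ⟨s, rfl⟩ := h.equivII.surjective x
  obtain rfl := hd
  have key (y z : X.S) (hyz : y.IsUniquelyCodimOneFace z) (hy : y = (h.equivII s).1.toS)
      (hz : z = (h.pairing.p (h.equivII s)).1.toS) {d : ℕ} (hd : y.dim = d)
      (hd' : (h.equivII s).1.dim = d) (e : hyz.index hd ≠ Fin.last _) :
      (h.pairing.isUniquelyCodimOneFace (h.equivII s)).index hd' ≠ Fin.last _ := by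
    subst hy hz
    exact e
  refine key _ _ (h.isUniquelyCodimOneFace s) rfl ?_ rfl rfl ?_
  · exact congr_arg (fun y : A.N ↦ y.toS) (h.type₁_pairing s)
  · rw [h.isUniquelyCodimOneFace_index]
    exact hl s

open prodStdSimplex in
/-- The shuffle filtration of `Δ[n] ⊗ Δ[m]` provided by `SSet.prodStdSimplex.pairingCore` only
attaches left horns when `k` is not the last vertex of `Δ[n]`. -/
lemma leftAnodyneMaps_horn_unionProd_boundary {n : ℕ} (k : Fin (n + 1)) (hn : 1 ≤ n)
    (hk : k < Fin.last n) (m : ℕ) :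
    leftAnodyneMaps (Subcomplex.unionProd.{u} Λ[n, k] ∂Δ[m]).ι := by
  obtain _ | n := n
  · lia
  obtain ⟨k, rfl⟩ := Fin.eq_castSucc_of_ne_last hk.ne
  rw [leftAnodyneMaps_eq_llp_rlp]
  refine transfiniteCompositionsOfShape_le _ _ _
    ⟨(pairingCore.{u} k m).pairing.rankFunction.relativeCellComplex.toTransfiniteCompositionOfShape,
      fun j hj ↦ ?_⟩
  refine (?_ : (_ : MorphismProperty _) ≤ _ ) _
    ((pairingCore.{u} k m).pairing.rankFunction.relativeCellComplex.attachCells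
      j hj).pushouts_coproducts
  simp only [pushouts_le_iff, coproducts_le_iff]
  rintro _ _ _ ⟨c⟩
  exact le_llp_rlp _ _ (.intro _ (by lia)
    (Fin.lt_last_iff_ne_last.2 ((pairingCore.{u} k m).index_ne_last
      (fun s ↦ (Fin.castSucc_lt_last s.index).ne) c.s rfl)))

variable {X₁ X₂ Y₁ Y₂ E B : SSet.{u}} {i : X₁ ⟶ Y₁} {j : X₂ ⟶ Y₂} {p : E ⟶ B}

/-- The pullback-hom of a monomorphism and a left fibration is a left fibration. -/
lemma leftFibrations_pullbackObjObjπ [Mono i] (hp : leftFibrations p)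
    (sq₁₃ : MonoidalClosed.internalHom.PullbackObjObj i p) :
    leftFibrations sq₁₃.π := by
  rw [leftFibrations_eq_rlp]
  rintro _ _ _ ⟨k, hn, hk⟩
  let sq₁₂ := Functor.PushoutObjObj.ofHasPushout (curriedTensor SSet) i Λ[_, k].ι
  rw [← internalHomAdjunction₂.hasLiftingProperty_iff sq₁₂]
  rw [HasLiftingProperty.iff_of_arrow_iso_left
    (show CategoryTheory.Arrow.mk sq₁₂.ι ≅ CategoryTheory.Arrow.mk sq₁₂.flipTensor.ι from
      CategoryTheory.Arrow.isoMk (Iso.refl _) (β_ _ _))]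
  let sq₁₃' := Functor.PullbackObjObj.ofHasPullback MonoidalClosed.internalHom Λ[_, k].ι p
  rw [internalHomAdjunction₂.hasLiftingProperty_iff _ sq₁₃']
  suffices (MorphismProperty.monomorphisms _).rlp sq₁₃'.π from this _ inferInstance
  rw [rlp_monomorphisms]
  rintro _ _ _ ⟨n⟩
  rw [← internalHomAdjunction₂.hasLiftingProperty_iff
    (Subcomplex.unionProd.pushoutObjObj.{u} _ _),
    Subcomplex.unionProd.pushoutObjObj_ι]
  exact hp _ (leftAnodyneMaps_horn_unionProd_boundary k hn hk n)

lemma leftAnodyneMaps_pushoutObjObjι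
    (sq₁₂ : (curriedTensor _).PushoutObjObj i j) [Mono i] (hj : leftAnodyneMaps j) :
    leftAnodyneMaps sq₁₂.ι := by
  rw [leftAnodyneMaps_eq_llp_rlp] at hj ⊢
  intro E B p hp
  let sq₁₃ := Functor.PullbackObjObj.ofHasPullback MonoidalClosed.internalHom i p
  rw [internalHomAdjunction₂.hasLiftingProperty_iff _ sq₁₃]
  apply hj
  rw [← leftFibrations_eq_rlp] at hp ⊢
  exact leftFibrations_pullbackObjObjπ hp sq₁₃

lemma leftAnodyneMaps_pushoutObjObjι'
    (sq₁₂ : (curriedTensor _).PushoutObjObj i j) [Mono j] (hi : leftAnodyneMaps i) :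
    leftAnodyneMaps sq₁₂.ι := by
  refine (leftAnodyneMaps.arrow_mk_iso_iff ?_).1
    (leftAnodyneMaps_pushoutObjObjι sq₁₂.flipTensor hi)
  exact CategoryTheory.Arrow.isoMk (Iso.refl _) (β_ _ _)

end SSet

namespace SSet

open MorphismProperty Limits MonoidalCategory MonoidalClosed CartesianMonoidalCategory

/-! ### Lifting homotopies -/

/-- Simplices of `∂Δ[1]` are constant. -/
lemma boundary_one_apply_eq {n : SimplexCategoryᵒᵖ} (t : (∂Δ[1] : SSet.{u}).obj n)
    (a b : Fin (n.unop.len + 1)) :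
    stdSimplex.asOrderHom t.1 a = stdSimplex.asOrderHom t.1 b := by
  by_contra h
  refine t.2 fun c ↦ ?_
  have h' : c = stdSimplex.asOrderHom t.1 a ∨ c = stdSimplex.asOrderHom t.1 b := by
    revert h
    generalize stdSimplex.asOrderHom t.1 a = x
    generalize stdSimplex.asOrderHom t.1 b = y
    revert x y c
    decide
  obtain rfl | rfl := h'
  · exact ⟨a, rfl⟩
  · exact ⟨b, rfl⟩

/-- A simplex of `Δ[1]` all of whose vertices are `c` is the value of the constant map `c`, at any
simplex of any simplicial set. -/
lemma eq_const_app_of_asOrderHom {K : SSet.{u}} {n : SimplexCategoryᵒᵖ} (x : K.obj n)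
    (t : (Δ[1] : SSet.{u}).obj n) (c : Fin 2) (h : ∀ a, stdSimplex.asOrderHom t a = c) :
    (SSet.const (X := K) (stdSimplex.obj₀Equiv.{u}.symm c)).app n x = t := by
  apply stdSimplex.objEquiv.injective
  ext a
  exact congr_arg Fin.val (h a).symm

/-- The map `K ⊗ ∂Δ[1] ⟶ E` which is `f` on `K ⊗ {0}` and `g` on `K ⊗ {1}`. -/
noncomputable def ofEnds {K E : SSet.{u}} (f g : K ⟶ E) : K ⊗ (∂Δ[1] : SSet.{u}) ⟶ E where
  app n := ↾fun x ↦ if stdSimplex.asOrderHom x.2.1 0 = 0 then f.app n x.1 else g.app n x.1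
  naturality n m α := by
    ext ⟨x, t⟩
    have : stdSimplex.asOrderHom ((∂Δ[1] : SSet.{u}).map α t).1 0 =
      stdSimplex.asOrderHom t.1 0 := boundary_one_apply_eq t _ _
    change (if stdSimplex.asOrderHom ((∂Δ[1] : SSet.{u}).map α t).1 0 = 0 then
      f.app m (K.map α x) else g.app m (K.map α x)) = E.map α (ite _ _ _)
    rw [this]
    split_ifs
    · exact NatTrans.naturality_apply f α x
    · exact NatTrans.naturality_apply g α x

lemma ofEnds_app_of_eq_zero {K E : SSet.{u}} (f g : K ⟶ E) {n : SimplexCategoryᵒᵖ}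
    (x : (K ⊗ (∂Δ[1] : SSet.{u})).obj n) (h : stdSimplex.asOrderHom x.2.1 0 = 0) :
    (ofEnds f g).app n x = f.app n x.1 := if_pos h

lemma ofEnds_app_of_ne_zero {K E : SSet.{u}} (f g : K ⟶ E) {n : SimplexCategoryᵒᵖ}
    (x : (K ⊗ (∂Δ[1] : SSet.{u})).obj n) (h : stdSimplex.asOrderHom x.2.1 0 ≠ 0) :
    (ofEnds f g).app n x = g.app n x.1 := if_neg h

lemma ofEnds_comp {K E B : SSet.{u}} (f g : K ⟶ E) (r : E ⟶ B) :
    ofEnds f g ≫ r = ofEnds (f ≫ r) (g ≫ r) := by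
  ext n x
  by_cases h : stdSimplex.asOrderHom x.2.1 0 = 0
  · exact (congr_arg (r.app n) (ofEnds_app_of_eq_zero f g x h)).trans
      (ofEnds_app_of_eq_zero (f ≫ r) (g ≫ r) x h).symm
  · exact (congr_arg (r.app n) (ofEnds_app_of_ne_zero f g x h)).trans
      (ofEnds_app_of_ne_zero (f ≫ r) (g ≫ r) x h).symm

lemma comp_ofEnds {K L E : SSet.{u}} (i : K ⟶ L) (f g : L ⟶ E) :
    i ▷ _ ≫ ofEnds f g = ofEnds (i ≫ f) (i ≫ g) := rfl

lemma whiskerLeft_boundary_one_ι_comp {K E : SSet.{u}} (h : K ⊗ Δ[1] ⟶ E) :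
    K ◁ Subcomplex.ι ∂Δ[1] ≫ h = ofEnds (ι₀ ≫ h) (ι₁ ≫ h) := by
  ext n ⟨x, t⟩
  by_cases ht : stdSimplex.asOrderHom t.1 0 = 0
  · refine Eq.trans ?_ (ofEnds_app_of_eq_zero _ _ (x, t) ht).symm
    refine congr_arg (h.app n) (Prod.ext rfl (eq_const_app_of_asOrderHom x t.1 0 ?_).symm)
    exact fun a ↦ (boundary_one_apply_eq t a 0).trans ht
  · refine Eq.trans ?_ (ofEnds_app_of_ne_zero _ _ (x, t) ht).symm
    refine congr_arg (h.app n) (Prod.ext rfl (eq_const_app_of_asOrderHom x t.1 1 ?_).symm)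
    exact fun a ↦ (boundary_one_apply_eq t a 0).trans (Fin.eq_one_of_ne_zero _ ht)

lemma const_mem_boundary_one (n : SimplexCategoryᵒᵖ) (c : Fin 2) :
    stdSimplex.const 1 c n ∈ (∂Δ[1] : (Δ[1] : SSet.{u}).Subcomplex).obj n := by
  intro h
  obtain ⟨_, h₀⟩ := h 0
  obtain ⟨_, h₁⟩ := h 1
  exact zero_ne_one (h₀.symm.trans h₁)

lemma ofEnds_injective {K E : SSet.{u}} {f g f' g' : K ⟶ E} (h : ofEnds f g = ofEnds f' g') :
    f = f' ∧ g = g' := by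
  constructor
  · ext n x
    exact congr_arg (fun φ ↦ φ.app n ((x, (⟨stdSimplex.const 1 0 n, const_mem_boundary_one n 0⟩ :
      (∂Δ[1] : SSet.{u}).obj n)) : (K ⊗ (∂Δ[1] : SSet.{u})).obj n)) h
  · ext n x
    exact congr_arg (fun φ ↦ φ.app n ((x, (⟨stdSimplex.const 1 1 n, const_mem_boundary_one n 1⟩ :
      (∂Δ[1] : SSet.{u}).obj n)) : (K ⊗ (∂Δ[1] : SSet.{u})).obj n)) h

/-- The right lifting property against the pushout-product of `i` and `∂Δ[1] ⟶ Δ[1]` allows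
homotopies to be lifted, with both ends and the restriction along `i` prescribed. -/
lemma exists_lift_homotopy {K L E B : SSet.{u}} {i : K ⟶ L} {r : E ⟶ B}
    (sq : (curriedTensor SSet.{u}).PushoutObjObj i (Subcomplex.ι ∂Δ[1]))
    [HasLiftingProperty sq.ι r] (f g : L ⟶ E) (hK : K ⊗ Δ[1] ⟶ E) (hB : L ⊗ Δ[1] ⟶ B)
    (h₀ : ι₀ ≫ hK = i ≫ f) (h₁ : ι₁ ≫ hK = i ≫ g)
    (h₀' : ι₀ ≫ hB = f ≫ r) (h₁' : ι₁ ≫ hB = g ≫ r) (w : hK ≫ r = i ▷ _ ≫ hB) :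
    ∃ h : L ⊗ Δ[1] ⟶ E, ι₀ ≫ h = f ∧ ι₁ ≫ h = g ∧ i ▷ _ ≫ h = hK ∧ h ≫ r = hB := by
  have comm : CommSq (sq.isPushout.desc (ofEnds f g) hK
      ((comp_ofEnds i f g).trans (by
        rw [← h₀, ← h₁]
        exact (whiskerLeft_boundary_one_ι_comp hK).symm))) sq.ι r hB := ⟨by
    apply sq.isPushout.hom_ext
    · rw [sq.isPushout.inl_desc_assoc, sq.inl_ι_assoc, ofEnds_comp, ← h₀', ← h₁']
      exact (whiskerLeft_boundary_one_ι_comp hB).symm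
    · rw [sq.isPushout.inr_desc_assoc, sq.inr_ι_assoc]
      exact w⟩
  have e₁ : L ◁ Subcomplex.ι ∂Δ[1] ≫ comm.lift = ofEnds f g := by
    have := sq.inl ≫= comm.fac_left
    rwa [sq.isPushout.inl_desc, sq.inl_ι_assoc] at this
  have e₂ : i ▷ _ ≫ comm.lift = hK := by
    have := sq.inr ≫= comm.fac_left
    rwa [sq.isPushout.inr_desc, sq.inr_ι_assoc] at this
  rw [whiskerLeft_boundary_one_ι_comp] at e₁
  obtain ⟨e₃, e₄⟩ := ofEnds_injective e₁
  exact ⟨comm.lift, e₃, e₄, e₂, comm.fac_right⟩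

/-- Simplices of `Λ[1, 0]` are constant with value `0`. -/
lemma horn_one_zero_apply {n : SimplexCategoryᵒᵖ} (t : (Λ[1, 0] : SSet.{u}).obj n)
    (a : Fin (n.unop.len + 1)) : stdSimplex.asOrderHom t.1 a = 0 := by
  by_contra h
  refine t.2 (Set.eq_univ_of_forall fun c ↦ ?_)
  obtain rfl | rfl : c = 0 ∨ c = 1 := by revert c; decide
  · exact Or.inr rfl
  · exact Or.inl ⟨a, Fin.eq_one_of_ne_zero _ h⟩

lemma whiskerLeft_horn_one_zero_ι_comp {K E : SSet.{u}} (h : K ⊗ Δ[1] ⟶ E) :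
    K ◁ Subcomplex.ι Λ[1, 0] ≫ h = fst _ _ ≫ ι₀ ≫ h := by
  ext n ⟨x, t⟩
  exact congr_arg (h.app n)
    (Prod.ext rfl (eq_const_app_of_asOrderHom x t.1 0 (horn_one_zero_apply t)).symm)

lemma const_mem_horn_one_zero (n : SimplexCategoryᵒᵖ) :
    stdSimplex.const 1 0 n ∈ (Λ[1, 0] : (Δ[1] : SSet.{u}).Subcomplex).obj n := by
  intro h
  obtain ⟨_, h⟩ | h := h.symm ▸ Set.mem_univ (1 : Fin 2)
  · exact zero_ne_one h
  · exact one_ne_zero h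

lemma fst_horn_one_zero_injective {K E : SSet.{u}} {f g : K ⟶ E}
    (h : fst K (Λ[1, 0] : SSet.{u}) ≫ f = fst _ _ ≫ g) : f = g := by
  ext n x
  exact congr_arg (fun φ ↦ φ.app n ((x, (⟨stdSimplex.const 1 0 n, const_mem_horn_one_zero n⟩ :
    (Λ[1, 0] : SSet.{u}).obj n)) : (K ⊗ (Λ[1, 0] : SSet.{u})).obj n)) h

/-- The right lifting property against the pushout-product of `i` and `{0} ⟶ Δ[1]` allows
homotopies to be lifted, with the initial end and the restriction along `i` prescribed. -/
lemma exists_lift_homotopy_of_initial {K L E B : SSet.{u}} {i : K ⟶ L} {r : E ⟶ B}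
    (sq : (curriedTensor SSet.{u}).PushoutObjObj i (Subcomplex.ι Λ[1, 0]))
    [HasLiftingProperty sq.ι r] (f : L ⟶ E) (hK : K ⊗ Δ[1] ⟶ E) (hB : L ⊗ Δ[1] ⟶ B)
    (h₀ : ι₀ ≫ hK = i ≫ f) (h₀' : ι₀ ≫ hB = f ≫ r) (w : hK ≫ r = i ▷ _ ≫ hB) :
    ∃ h : L ⊗ Δ[1] ⟶ E, ι₀ ≫ h = f ∧ i ▷ _ ≫ h = hK ∧ h ≫ r = hB := by
  have comm : CommSq (sq.isPushout.desc (fst _ _ ≫ f) hK (by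
        refine Eq.trans ?_ (whiskerLeft_horn_one_zero_ι_comp hK).symm
        rw [h₀]
        rfl)) sq.ι r hB := ⟨by
    apply sq.isPushout.hom_ext
    · rw [sq.isPushout.inl_desc_assoc, sq.inl_ι_assoc]
      refine Eq.trans ?_ (whiskerLeft_horn_one_zero_ι_comp hB).symm
      rw [h₀', Category.assoc]
    · rw [sq.isPushout.inr_desc_assoc, sq.inr_ι_assoc]
      exact w⟩
  have e₁ : L ◁ Subcomplex.ι Λ[1, 0] ≫ comm.lift = fst _ _ ≫ f := by
    have := sq.inl ≫= comm.fac_left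
    rwa [sq.isPushout.inl_desc, sq.inl_ι_assoc] at this
  have e₂ : i ▷ _ ≫ comm.lift = hK := by
    have := sq.inr ≫= comm.fac_left
    rwa [sq.isPushout.inr_desc, sq.inr_ι_assoc] at this
  rw [whiskerLeft_horn_one_zero_ι_comp] at e₁
  exact ⟨comm.lift, fst_horn_one_zero_injective e₁, e₂, comm.fac_right⟩

/-! ### Left fibrations that are trivial Kan fibrations -/

lemma hasLiftingProperty_boundary_unionProd_horn {E B : SSet.{u}} {p : E ⟶ B}
    (hp : leftFibrations p) (n : ℕ) :
    HasLiftingProperty (Subcomplex.unionProd.pushoutObjObj ∂Δ[n] (Λ[1, 0] :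
      (Δ[1] : SSet.{u}).Subcomplex)).ι p :=
  hp _ (leftAnodyneMaps_pushoutObjObjι _ (leftAnodyneMaps_horn_ι 0 le_rfl (by simp)))

/-- If `p` is a left fibration such that `q` and `p ≫ q` are trivial Kan fibrations, then `p` is a
trivial Kan fibration: a lift in a square for `p ≫ q` is a lift for `p` up to a homotopy relative to
the boundary, and `p` allows to transport it along this homotopy. -/
lemma trivialKanFibrations_of_postcomp {E B C : SSet.{u}} {p : E ⟶ B} {q : B ⟶ C}
    (hp : leftFibrations p) (hq : trivialKanFibrations q) (hpq : trivialKanFibrations (p ≫ q)) :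
    trivialKanFibrations p := by
  rintro _ _ _ ⟨n⟩
  constructor
  intro a b sq
  have := hpq _ ⟨n⟩
  have sq' : CommSq a ∂Δ[n].ι (p ≫ q) (b ≫ q) := ⟨by rw [sq.w_assoc]⟩
  have : HasLiftingProperty (Subcomplex.unionProd.pushoutObjObj ∂Δ[n] (∂Δ[1] :
      (Δ[1] : SSet.{u}).Subcomplex)).ι q := by
    rw [trivialKanFibrations_eq_rlp] at hq
    refine hq _ ?_
    rw [Subcomplex.unionProd.pushoutObjObj_ι]
    exact inferInstanceAs (Mono (Subfunctor.ι _))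
  -- a homotopy relative to the boundary, and over `C`, from a lift for `p ≫ q` to `b`
  obtain ⟨h, h₀, h₁, h₂, h₃⟩ := exists_lift_homotopy (r := q)
    (Subcomplex.unionProd.pushoutObjObj ∂Δ[n] (∂Δ[1] : (Δ[1] : SSet.{u}).Subcomplex))
    (sq'.lift ≫ p) b (fst _ _ ≫ a ≫ p) (fst _ _ ≫ b ≫ q)
    (by rw [sq'.fac_left_assoc]; rfl) (by rw [← sq.w]; rfl)
    (by rw [Category.assoc, sq'.fac_right]; rfl) rfl
    (congr_arg (fun φ ↦ fst _ _ ≫ φ ≫ q) sq.w)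
  have := hasLiftingProperty_boundary_unionProd_horn hp n
  obtain ⟨k, k₀, k₁, k₂⟩ := exists_lift_homotopy_of_initial (r := p)
    (Subcomplex.unionProd.pushoutObjObj ∂Δ[n] (Λ[1, 0] : (Δ[1] : SSet.{u}).Subcomplex))
    sq'.lift (fst _ _ ≫ a) h (by rw [sq'.fac_left]; rfl) h₀ (by rw [h₂, Category.assoc])
  refine ⟨⟨⟨ι₁ ≫ k, ?_, ?_⟩⟩⟩
  · rw [← ι₁_comp_assoc, k₁]
    rfl
  · rw [Category.assoc, k₂, h₁]

/-- If the composition of a left anodyne map `i` and a left fibration `p` is right cofinal, then `p`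
is a trivial Kan fibration: it is, up to a homotopy over the base, a retract of a trivial Kan
fibration. -/
lemma trivialKanFibrations_of_rightCofinalMaps_comp {X Z Y : SSet.{u}} {i : X ⟶ Z} {p : Z ⟶ Y}
    (hi : leftAnodyneMaps i) (hp : leftFibrations p) (hip : rightCofinalMaps (i ≫ p)) :
    trivialKanFibrations p := by
  obtain ⟨B, j, q, hj, hq, fac⟩ := hip
  have := hp _ hj
  have := trivialKanFibrations_le_leftFibrations _ hq _ hi
  have sq₁ : CommSq i j p q := ⟨fac.symm⟩
  have sq₂ : CommSq j i q p := ⟨fac⟩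
  -- a homotopy over `Y`, constant on `X`, from `sq₂.lift ≫ sq₁.lift` to the identity
  let sq := Functor.PushoutObjObj.ofHasPushout (curriedTensor SSet.{u}) i (Subcomplex.ι ∂Δ[1])
  have : HasLiftingProperty sq.ι p := hp _ (leftAnodyneMaps_pushoutObjObjι' _ hi)
  obtain ⟨h, h₀, h₁, h₂, h₃⟩ := exists_lift_homotopy (r := p) sq (sq₂.lift ≫ sq₁.lift) (𝟙 Z)
    (fst _ _ ≫ i) (fst _ _ ≫ p)
    (by rw [sq₂.fac_left_assoc, sq₁.fac_left]; rfl) (by rw [Category.comp_id]; rfl)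
    (by rw [Category.assoc, sq₁.fac_right, sq₂.fac_right]; rfl) rfl rfl
  rintro _ _ _ ⟨n⟩
  constructor
  intro a b sq
  have := hq _ ⟨n⟩
  have sq' : CommSq (a ≫ sq₂.lift) ∂Δ[n].ι q b := ⟨by
    rw [Category.assoc, sq₂.fac_right, sq.w]⟩
  have := hasLiftingProperty_boundary_unionProd_horn hp n
  -- a lift for `q`, pushed to `Z`, is moved along `h` on the boundary
  obtain ⟨k, k₀, k₁, k₂⟩ := exists_lift_homotopy_of_initial (r := p)
    (Subcomplex.unionProd.pushoutObjObj ∂Δ[n] (Λ[1, 0] : (Δ[1] : SSet.{u}).Subcomplex))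
    (sq'.lift ≫ sq₁.lift) (a ▷ _ ≫ h) (fst _ _ ≫ b)
    (by rw [ι₀_comp_assoc, h₀, sq'.fac_left_assoc, Category.assoc])
    (by rw [Category.assoc, sq₁.fac_right, sq'.fac_right]; rfl)
    (by rw [Category.assoc, h₃, whiskerRight_fst_assoc, whiskerRight_fst_assoc, sq.w])
  refine ⟨⟨⟨ι₁ ≫ k, ?_, ?_⟩⟩⟩
  · rw [← ι₁_comp_assoc, k₁, ι₁_comp_assoc, h₁, Category.comp_id]
  · rw [Category.assoc, k₂]
    rfl

end SSet

namespace SSet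

open MorphismProperty Limits

/-! ### Generalized horns -/

namespace stdSimplex

/-- The set of vertices of a simplex of `Δ[n]`. -/
def support {n : ℕ} ⦃U : SimplexCategoryᵒᵖ⦄ (x : (Δ[n] : SSet.{u}).obj U) : Finset (Fin (n + 1)) :=
  Finset.univ.image (asOrderHom x)

lemma support_map_subset {n : ℕ} ⦃U V : SimplexCategoryᵒᵖ⦄ (f : U ⟶ V)
    (x : (Δ[n] : SSet.{u}).obj U) : support ((Δ[n] : SSet.{u}).map f x) ⊆ support x := by
  intro i hi
  obtain ⟨j, -, rfl⟩ := Finset.mem_image.1 hi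
  exact Finset.mem_image_of_mem _ (Finset.mem_univ (f.unop.toOrderHom j))

lemma support_nonempty {n : ℕ} ⦃U : SimplexCategoryᵒᵖ⦄ (x : (Δ[n] : SSet.{u}).obj U) :
    (support x).Nonempty :=
  Finset.univ_nonempty.image _

lemma support_map_app {m n : ℕ} (e : ⦋m⦌ ⟶ ⦋n⦌) ⦃U : SimplexCategoryᵒᵖ⦄
    (x : (Δ[m] : SSet.{u}).obj U) :
    support ((stdSimplex.{u}.map e).app U x) = (support x).image e.toOrderHom :=
  (Finset.image_image (f := asOrderHom x) (g := e.toOrderHom)).symm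

lemma mem_range_map_iff {m n : ℕ} (e : ⦋m⦌ ⟶ ⦋n⦌) (he : Function.Injective e.toOrderHom)
    ⦃U : SimplexCategoryᵒᵖ⦄ (x : (Δ[n] : SSet.{u}).obj U) :
    x ∈ (Subfunctor.range (stdSimplex.{u}.map e)).obj U ↔
      support x ⊆ Finset.univ.image e.toOrderHom := by
  constructor
  · rintro ⟨y, rfl⟩
    rw [support_map_app]
    exact Finset.image_subset_image (Finset.subset_univ _)
  · intro h
    have h' (a : Fin (U.unop.len + 1)) : ∃ b, e.toOrderHom b = asOrderHom x a := by
      obtain ⟨b, -, hb⟩ := Finset.mem_image.1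
        (h (Finset.mem_image_of_mem _ (Finset.mem_univ a)))
      exact ⟨b, hb⟩
    choose f hf using h'
    have hle (a b) (hab : a ≤ b) : f a ≤ f b := by
      by_contra hlt
      have h₁ := e.toOrderHom.monotone (not_le.1 hlt).le
      rw [hf, hf] at h₁
      have h₂ := le_antisymm ((asOrderHom x).monotone hab) h₁
      rw [← hf, ← hf] at h₂
      exact hlt (he h₂).le
    refine ⟨objEquiv.symm (SimplexCategory.Hom.mk ⟨f, hle⟩), ?_⟩
    apply objEquiv.injective
    ext a
    exact congr_arg Fin.val (hf a)

lemma mono_map {m n : ℕ} (e : ⦋m⦌ ⟶ ⦋n⦌) (he : Function.Injective e.toOrderHom) :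
    Mono (stdSimplex.{u}.map e) := by
  have (U : SimplexCategoryᵒᵖ) : Mono ((stdSimplex.{u}.map e).app U) := by
    rw [mono_iff_injective]
    intro x y h
    apply objEquiv.injective
    ext a
    exact congr_arg Fin.val (he (congr_arg (fun z ↦ asOrderHom z a) h))
  exact NatTrans.mono_of_mono_app _

/-- Each nonempty set of vertices of `Δ[n]` spans a face. -/
lemma exists_face {n : ℕ} (T : Finset (Fin (n + 1))) (hT : T.Nonempty) :
    ∃ (t : ℕ) (e : ⦋t⦌ ⟶ ⦋n⦌), Function.Injective e.toOrderHom ∧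
      Finset.univ.image e.toOrderHom = T := by
  obtain ⟨t, ht⟩ := Nat.exists_eq_succ_of_ne_zero hT.card_ne_zero
  refine ⟨t, SimplexCategory.Hom.mk (T.orderEmbOfFin ht).toOrderHom,
    (T.orderEmbOfFin ht).injective, ?_⟩
  exact T.image_orderEmbOfFin_univ ht

end stdSimplex

open SSet.stdSimplex

/-- The generalized horn in `Δ[n]` attached to a set `V` of vertices: the union of the faces
opposite to the elements of `V`. It consists of the simplices which miss some element of `V`. -/
def generalizedHorn {n : ℕ} (V : Finset (Fin (n + 1))) : (Δ[n] : SSet.{u}).Subcomplex where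
  obj _ := {x | ¬ V ⊆ support x}
  map f x hx h := hx (h.trans (support_map_subset f x))

lemma mem_generalizedHorn {n : ℕ} {V : Finset (Fin (n + 1))} {U : SimplexCategoryᵒᵖ}
    (x : (Δ[n] : SSet.{u}).obj U) :
    x ∈ (generalizedHorn V).obj U ↔ ¬ V ⊆ support x := Iff.rfl

lemma generalizedHorn_mono {n : ℕ} {V V' : Finset (Fin (n + 1))} (h : V ⊆ V') :
    generalizedHorn.{u} V ≤ generalizedHorn V' :=
  fun _ _ hx h' ↦ hx (h.trans h')

lemma generalizedHorn_univ (n : ℕ) :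
    generalizedHorn Finset.univ = (∂Δ[n] : Subcomplex.{u} _) := by
  ext U x
  refine not_congr ⟨fun h i ↦ ?_, fun h i _ ↦ ?_⟩
  · obtain ⟨j, -, hj⟩ := Finset.mem_image.1 (h (Finset.mem_univ i))
    exact ⟨j, hj⟩
  · obtain ⟨j, hj⟩ := h i
    exact Finset.mem_image.2 ⟨j, Finset.mem_univ j, hj⟩

lemma generalizedHorn_compl_singleton {n : ℕ} (k : Fin (n + 1)) :
    generalizedHorn {k}ᶜ = (Λ[n, k] : Subcomplex.{u} _) := by
  ext U x
  refine not_congr ⟨fun h ↦ Set.eq_univ_of_forall fun i ↦ ?_, fun h i hi ↦ ?_⟩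
  · by_cases hi : i = k
    · exact Or.inr hi
    · obtain ⟨j, -, hj⟩ := Finset.mem_image.1 (h (x := i) (by simpa using hi))
      exact Or.inl ⟨j, hj⟩
  · obtain ⟨j, hj⟩ | h' := h.symm ▸ Set.mem_univ i
    · exact Finset.mem_image.2 ⟨j, Finset.mem_univ j, hj⟩
    · exact ((Finset.mem_compl.1 hi) (Finset.mem_singleton.2 h')).elim

lemma generalizedHorn_empty (n : ℕ) :
    generalizedHorn ∅ = (⊥ : (Δ[n] : SSet.{u}).Subcomplex) := by
  ext U x
  exact ⟨fun h ↦ h (Finset.empty_subset _), False.elim⟩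

lemma preimage_generalizedHorn {m n : ℕ} (e : ⦋m⦌ ⟶ ⦋n⦌) (he : Function.Injective e.toOrderHom)
    (V : Finset (Fin (n + 1))) (hV : V ⊆ Finset.univ.image e.toOrderHom) :
    Subfunctor.preimage (generalizedHorn V) (stdSimplex.{u}.map e) =
      generalizedHorn (V.preimage e.toOrderHom he.injOn) := by
  ext U x
  refine not_congr ((iff_of_eq (congr_arg _ (support_map_app e x))).trans
    ⟨fun h i hi ↦ ?_, fun h i hi ↦ ?_⟩)
  · obtain ⟨j, hj, hj'⟩ := Finset.mem_image.1 (h (Finset.mem_preimage.1 hi))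
    exact he hj' ▸ hj
  · obtain ⟨j, -, rfl⟩ := Finset.mem_image.1 (hV hi)
    exact Finset.mem_image_of_mem _ (h (Finset.mem_preimage.2 hi))

lemma injective_δ {n : ℕ} (i : Fin (n + 2)) :
    Function.Injective (SimplexCategory.δ i).toOrderHom :=
  Fin.succAbove_right_injective

lemma univ_image_δ {n : ℕ} (i : Fin (n + 2)) :
    Finset.univ.image (SimplexCategory.δ i).toOrderHom = {i}ᶜ := by
  ext j
  simp only [Finset.mem_image, Finset.mem_univ, true_and, Finset.mem_compl, Finset.mem_singleton]
  exact ⟨by rintro ⟨a, rfl⟩; exact Fin.succAbove_ne i a, fun h ↦ Fin.exists_succAbove_eq h⟩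

lemma generalizedHorn_insert {n : ℕ} (V : Finset (Fin (n + 2))) (i : Fin (n + 2)) :
    generalizedHorn.{u} (insert i V) =
      generalizedHorn V ⊔ Subfunctor.range (stdSimplex.{u}.map (SimplexCategory.δ i)) := by
  ext U x
  change _ ↔ ¬ V ⊆ support x ∨ x ∈ (Subfunctor.range _).obj U
  rw [mem_range_map_iff _ (injective_δ i), univ_image_δ, mem_generalizedHorn,
    Finset.insert_subset_iff, Finset.subset_compl_singleton]
  tauto

lemma card_preimage_of_subset {α β : Type*} [Fintype α] [DecidableEq β] {f : α → β}
    (hf : Function.Injective f) {V : Finset β} (hV : V ⊆ Finset.univ.image f) :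
    (V.preimage f hf.injOn).card = V.card := by
  classical
  rw [← Finset.card_image_of_injective _ hf, Finset.image_preimage, Finset.filter_true_of_mem]
  intro x hx
  obtain ⟨y, -, rfl⟩ := Finset.mem_image.1 (hV hx)
  exact ⟨y, rfl⟩

variable (T : MorphismProperty SSet.{u}) [T.IsMultiplicative] [T.IsStableUnderCobaseChange]

/-- The generalized horn of `insert i V` is obtained from the one of `V` by attaching the face
opposite to `i` along a generalized horn of this face. -/
lemma homOfLe_generalizedHorn_insert {n : ℕ} (V : Finset (Fin (n + 2))) (i : Fin (n + 2))
    (hi : i ∉ V)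
    (hT : T (generalizedHorn
      (V.preimage (SimplexCategory.δ i).toOrderHom (injective_δ i).injOn)).ι) :
    T (Subfunctor.homOfLe (generalizedHorn_mono.{u} (Finset.subset_insert i V))) := by
  have := mono_map.{u} (SimplexCategory.δ i) (injective_δ i)
  have h := Subfunctor.homOfLe_sup_range T (generalizedHorn V)
    (stdSimplex.{u}.map (SimplexCategory.δ i)) (by
      rw [preimage_generalizedHorn _ (injective_δ i) _ (by
        rwa [univ_image_δ, Finset.subset_compl_singleton])]
      exact hT)
  exact T.comp_mem _ _ h (Subfunctor.homOfLe_of_eq T (generalizedHorn_insert V i).symm)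

lemma exists_δ_eq_of_lt {n : ℕ} {i k w : Fin (n + 2)} (hk : i ≠ k) (hw : i ≠ w) (h : k < w) :
    ∃ k' w', (SimplexCategory.δ i).toOrderHom k' = k ∧ (SimplexCategory.δ i).toOrderHom w' = w ∧
      k' < w' := by
  obtain ⟨k', rfl⟩ := Fin.exists_succAbove_eq hk.symm
  obtain ⟨w', rfl⟩ := Fin.exists_succAbove_eq hw.symm
  exact ⟨k', w', rfl, rfl, (Fin.succAbove_lt_succAbove_iff).1 h⟩

/-- A class of monomorphisms with right cancellation which contains the inclusions of the initial
vertices contains the generalized horns of all `V` such that some element of `V` is preceded by a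
vertex outside `V`. This is an induction on the cardinality of `V`. -/
lemma generalizedHorn_ι_mem_of_initial_vertex
    (hT : ∀ ⦃X Y Z : SSet.{u}⦄ (f : X ⟶ Y) (g : Y ⟶ Z) [Mono f] [Mono g],
      T f → T (f ≫ g) → T g)
    (h₀ : ∀ n, T (stdSimplex.{u}.map (SimplexCategory.const ⦋0⦌ ⦋n⦌ 0)))
    {n : ℕ} (V : Finset (Fin (n + 1))) {k w : Fin (n + 1)} (hk : k ∉ V) (hw : w ∈ V)
    (hkw : k < w) : T (generalizedHorn V).ι := by
  induction hV : V.card generalizing n V k w with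
  | zero => exact absurd (Finset.card_pos.2 ⟨w, hw⟩) hV.not_gt
  | succ c ih =>
    obtain _ | n := n
    · lia
    by_cases hV' : V = {w}
    -- `V = {w}` gives the face opposite to `w ≠ 0`, which contains the initial vertex
    · have hδ := mono_map.{u} (SimplexCategory.δ w) (injective_δ w)
      have h' : Mono (stdSimplex.{u}.map (SimplexCategory.const ⦋0⦌ ⦋n⦌ 0)) :=
        mono_map _ (fun _ _ _ ↦ Subsingleton.elim (α := Fin 1) _ _)
      have e : SimplexCategory.const ⦋0⦌ ⦋n⦌ 0 ≫ SimplexCategory.δ w =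
          SimplexCategory.const ⦋0⦌ ⦋n + 1⦌ 0 := by
        ext i : 3
        exact Fin.succAbove_ne_zero_zero (by rintro rfl; exact not_lt_bot hkw)
      have h := @hT _ _ _ _ (stdSimplex.{u}.map (SimplexCategory.δ w)) h' hδ (h₀ n) (by
        rw [(stdSimplex.{u}.map_comp _ _).symm.trans (congr_arg _ e)]
        exact h₀ (n + 1))
      have hrange : Subfunctor.range (stdSimplex.{u}.map (SimplexCategory.δ w)) =
          generalizedHorn V := by
        rw [hV', ← insert_empty_eq, generalizedHorn_insert, generalizedHorn_empty, bot_sup_eq]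
      rw [← hrange]
      have : IsIso (Subfunctor.toRange (stdSimplex.{u}.map (SimplexCategory.δ w))) :=
        inferInstance
      exact (T.arrow_mk_iso_iff (CategoryTheory.Arrow.isoMk (@asIso _ _ _ _ _ this)
        (Iso.refl _))).1 h
    · obtain ⟨i, hi, hiw⟩ : ∃ i ∈ V, i ≠ w := by
        by_contra! h
        exact hV' (Finset.eq_singleton_iff_unique_mem.2 ⟨hw, h⟩)
      obtain ⟨k', w', rfl, rfl, hkw'⟩ := exists_δ_eq_of_lt (by rintro rfl; exact hk hi) hiw hkw
      have hc : (V.erase i).card = c := by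
        rw [Finset.card_erase_of_mem hi, hV, Nat.add_sub_cancel]
      have h₁ := ih (V.erase i) (fun h ↦ hk (Finset.mem_of_mem_erase h))
        (Finset.mem_erase.2 ⟨hiw.symm, hw⟩) hkw hc
      have h₂ := homOfLe_generalizedHorn_insert T (V.erase i) i (Finset.notMem_erase i V)
        (ih _ (k := k') (w := w') (fun h ↦ hk (Finset.mem_of_mem_erase (Finset.mem_preimage.1 h)))
          (Finset.mem_preimage.2 (Finset.mem_erase.2 ⟨hiw.symm, hw⟩)) hkw' (by
            rw [card_preimage_of_subset (injective_δ i) (by simp [univ_image_δ]), hc]))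
      have h₃ := T.comp_mem _ _ h₂ (Subfunctor.homOfLe_of_eq T
        (congr_arg generalizedHorn (Finset.insert_erase hi)))
      have : Mono (Subfunctor.homOfLe (generalizedHorn_mono.{u} (Finset.erase_subset i V))) :=
        inferInstance
      have : Mono (generalizedHorn.{u} V).ι := inferInstanceAs (Mono (Subfunctor.ι _))
      exact hT _ (generalizedHorn V).ι h₃ h₁

/-- The generalized horn of `V` is left anodyne if some element of `V` is preceded by a vertex `k`
outside `V`: starting from the case of the horn `V = {k}ᶜ`, this is a descending induction on the
cardinality of `V`. -/
lemma leftAnodyneMaps_generalizedHorn_ι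
    {n : ℕ} (V : Finset (Fin (n + 1))) {k w : Fin (n + 1)} (hk : k ∉ V) (hw : w ∈ V)
    (hkw : k < w) : leftAnodyneMaps (generalizedHorn.{u} V).ι := by
  induction hV : Vᶜ.card generalizing n V k w with
  | zero => exact absurd (Finset.card_pos.2 ⟨k, Finset.mem_compl.2 hk⟩) hV.not_gt
  | succ c ih =>
    obtain _ | n := n
    · lia
    by_cases hV' : V = {k}ᶜ
    · subst hV'
      rw [generalizedHorn_compl_singleton]
      exact leftAnodyneMaps_horn_ι k (by lia) (hkw.trans_le (Fin.le_last w))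
    · obtain ⟨i, hi, hik⟩ : ∃ i ∉ V, i ≠ k := by
        by_contra! h
        refine hV' (Finset.ext fun i ↦ ?_)
        simp only [Finset.mem_compl, Finset.mem_singleton]
        exact ⟨fun h h' ↦ hk (h' ▸ h), fun hi ↦ by_contra fun h' ↦ hi (h i h')⟩
      obtain ⟨k', w', rfl, rfl, hkw'⟩ := exists_δ_eq_of_lt hik (by rintro rfl; exact hi hw) hkw
      have h₁ := ih (insert i V) (k := _) (w := _) (by simpa using ⟨hik.symm, hk⟩)
        (Finset.mem_insert_of_mem hw) hkw (by
          rw [Finset.compl_insert, Finset.card_erase_of_mem (Finset.mem_compl.2 hi), hV,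
            Nat.add_sub_cancel])
      have h₂ := homOfLe_generalizedHorn_insert leftAnodyneMaps V i hi
        (ih _ (k := k') (w := w') (fun h ↦ hk (Finset.mem_preimage.1 h))
          (Finset.mem_preimage.2 hw) hkw' (by
            rw [Finset.card_compl, Fintype.card_fin] at hV ⊢
            rw [card_preimage_of_subset (injective_δ i) (by
              rwa [univ_image_δ, Finset.subset_compl_singleton])]
            change n + 1 - _ = _
            lia))
      exact leftAnodyneMaps.comp_mem _ _ h₂ h₁

end SSet

namespace BiSSet

open MorphismProperty Limits

/-! ### The box product as a bifunctor -/

/-- The box product as a bifunctor. -/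
def boxFunctor : SSet.{u} ⥤ SSet.{u} ⥤ BiSSet.{u} where
  obj K :=
    { obj L := box K L
      map g := { app _ := ↾fun x ↦ (x.1, g.app _ x.2)
                 naturality _ _ f := by
                  ext ⟨x, y⟩
                  exact congr_arg (Prod.mk _) (NatTrans.naturality_apply g f.2 y) } }
  map f :=
    { app L := { app _ := ↾fun x ↦ (f.app _ x.1, x.2)
                 naturality _ _ g := by
                  ext ⟨x, y⟩
                  exact congr_arg (Prod.mk · _) (NatTrans.naturality_apply f g.1 x) } }

/-- The columns of bisimplicial sets. -/
def columns : BiSSet.{u} ⥤ SimplexCategoryᵒᵖ ⥤ SSet.{u} := Functor.curry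

/-- The rows of bisimplicial sets. -/
def rows : BiSSet.{u} ⥤ SimplexCategoryᵒᵖ ⥤ SSet.{u} := Functor.curry ⋙ flipFunctor _ _ _

/-- The simplicial set of maps from a simplicial set `K` to the rows of a bisimplicial set `X`,
`n ↦ Hom(K, X_{*n})`. -/
def homRows : SSet.{u}ᵒᵖ ⥤ BiSSet.{u} ⥤ SSet.{u} :=
  coyoneda ⋙ Functor.whiskeringRight _ _ _ ⋙ (Functor.whiskeringLeft _ _ _).obj rows

/-- The simplicial set of maps from a simplicial set `L` to the columns of a bisimplicial set `X`,
`m ↦ Hom(L, X_{m*})`. -/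
def homColumns : SSet.{u}ᵒᵖ ⥤ BiSSet.{u} ⥤ SSet.{u} :=
  coyoneda ⋙ Functor.whiskeringRight _ _ _ ⋙ (Functor.whiskeringLeft _ _ _).obj columns

/-- The adjunction between `K □ -` and `homRows K -`. -/
def boxHomRowsEquiv (K L : SSet.{u}) (X : BiSSet.{u}) :
    ((boxFunctor.obj K).obj L ⟶ X) ≃ (L ⟶ (homRows.obj (op K)).obj X) where
  toFun φ :=
    { app n := ↾fun l ↦
        ({ app m := ↾fun k ↦ φ.app (m, n) (k, l)
           naturality m m' f := by
             ext k
             refine Eq.trans ?_ (NatTrans.naturality_apply φ (Prod.mkHom f (𝟙 n)) 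
               ((k, l) : (box K L).obj (m, n)))
             exact congr_arg (fun l' ↦ φ.app (m', n) (K.map f k, l'))
               (L.map_id_apply _ l).symm } : K ⟶ (rows.obj X).obj n)
      naturality n n' f := by
        ext l
        refine NatTrans.ext (funext fun m ↦ ?_)
        ext k
        refine Eq.trans ?_ (NatTrans.naturality_apply φ (Prod.mkHom (𝟙 m) f) 
               ((k, l) : (box K L).obj (m, n)))
        exact congr_arg (fun k' ↦ φ.app (m, n') (k', L.map f l))
          (K.map_id_apply _ k).symm }
  invFun ψ :=
    { app a := ↾fun x ↦ (show K ⟶ (rows.obj X).obj a.2 from ψ.app a.2 x.2).app a.1 x.1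
      naturality a b f := by
        ext ⟨k, l⟩
        have h₁ := NatTrans.naturality_apply ψ f.2 l
        have h₂ := NatTrans.naturality_apply (show K ⟶ (rows.obj X).obj a.2 from ψ.app a.2 l) f.1 k
        refine (congr_arg (fun φ : K ⟶ (rows.obj X).obj b.2 ↦ φ.app b.1 (K.map f.1 k)) h₁).trans ?_
        refine (congr_arg (fun x ↦ X.map (Prod.mkHom (𝟙 b.1) f.2) x) h₂).trans ?_
        refine (X.map_comp_apply _ _ _).symm.trans ?_
        refine congr_arg (fun g ↦ X.map g _) (Prod.ext ?_ ?_)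
        · exact Category.comp_id _
        · exact Category.id_comp _ }
  left_inv φ := rfl
  right_inv ψ := rfl

/-- The parametrized adjunction given by `boxHomRowsEquiv`. -/
def boxAdjunction : boxFunctor.{u} ⊣₂ homRows :=
  ParametrizedAdjunction.mk' (fun K ↦ Adjunction.mkOfHomEquiv
    { homEquiv L X := boxHomRowsEquiv K L X
      homEquiv_naturality_left_symm _ _ := rfl
      homEquiv_naturality_right _ _ := rfl }) (by
    intros
    rw [Adjunction.mkOfHomEquiv_homEquiv, Adjunction.mkOfHomEquiv_homEquiv]
    rfl)

/-- The adjunction between `- □ L` and `homColumns L -`. -/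
def boxHomColumnsEquiv (K L : SSet.{u}) (X : BiSSet.{u}) :
    ((boxFunctor.flip.obj L).obj K ⟶ X) ≃ (K ⟶ (homColumns.obj (op L)).obj X) where
  toFun φ :=
    { app m := ↾fun k ↦
        ({ app n := ↾fun l ↦ φ.app (m, n) (k, l)
           naturality n n' f := by
             ext l
             refine Eq.trans ?_ (NatTrans.naturality_apply φ (Prod.mkHom (𝟙 m) f) 
               ((k, l) : (box K L).obj (m, n)))
             exact congr_arg (fun k' ↦ φ.app (m, n') (k', L.map f l))
               (K.map_id_apply _ k).symm } : L ⟶ (columns.obj X).obj m)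
      naturality m m' f := by
        ext k
        refine NatTrans.ext (funext fun n ↦ ?_)
        ext l
        refine Eq.trans ?_ (NatTrans.naturality_apply φ (Prod.mkHom f (𝟙 n)) 
               ((k, l) : (box K L).obj (m, n)))
        exact congr_arg (fun l' ↦ φ.app (m', n) (K.map f k, l'))
          (L.map_id_apply _ l).symm }
  invFun ψ :=
    { app a := ↾fun x ↦ (show L ⟶ (columns.obj X).obj a.1 from ψ.app a.1 x.1).app a.2 x.2
      naturality a b f := by
        ext ⟨k, l⟩
        have h₁ := NatTrans.naturality_apply ψ f.1 k
        have h₂ := NatTrans.naturality_apply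
          (show L ⟶ (columns.obj X).obj a.1 from ψ.app a.1 k) f.2 l
        refine (congr_arg (fun φ : L ⟶ (columns.obj X).obj b.1 ↦ φ.app b.2 (L.map f.2 l))
          h₁).trans ?_
        refine (congr_arg (fun x ↦ X.map (Prod.mkHom f.1 (𝟙 b.2)) x) h₂).trans ?_
        refine (X.map_comp_apply _ _ _).symm.trans ?_
        refine congr_arg (fun g ↦ X.map g _) (Prod.ext ?_ ?_)
        · exact Category.id_comp _
        · exact Category.comp_id _ }
  left_inv φ := rfl
  right_inv ψ := rfl

/-- The parametrized adjunction given by `boxHomColumnsEquiv`. -/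
def boxFlipAdjunction : boxFunctor.{u}.flip ⊣₂ homColumns :=
  ParametrizedAdjunction.mk' (fun L ↦ Adjunction.mkOfHomEquiv
    { homEquiv K X := boxHomColumnsEquiv K L X
      homEquiv_naturality_left_symm _ _ := rfl
      homEquiv_naturality_right _ _ := rfl }) (by
    intros
    rw [Adjunction.mkOfHomEquiv_homEquiv, Adjunction.mkOfHomEquiv_homEquiv]
    rfl)

end BiSSet

/-! ### Composition of pullback-homs -/

namespace CategoryTheory.Functor.PullbackObjObj

open Limits

universe v₁ v₂ v₃ u₁ u₂ u₃

variable {C₁ : Type u₁} {C₂ : Type u₂} {C₃ : Type u₃}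
  [Category.{v₁} C₁] [Category.{v₂} C₂] [Category.{v₃} C₃] {G : C₁ᵒᵖ ⥤ C₃ ⥤ C₂}
  {A B C : C₁} {i : A ⟶ B} {j : B ⟶ C} {X Y : C₃} {p : X ⟶ Y}

/-- The pullback-hom of a composition `i ≫ j` with `p` is the composition of the pullback-hom of
`j` with `p` and of a base change of the pullback-hom of `i` with `p`. -/
lemma exists_π_comp_eq (sq : G.PullbackObjObj i p) (sq' : G.PullbackObjObj j p)
    (sq'' : G.PullbackObjObj (i ≫ j) p) :
    ∃ (q : sq'.pt ⟶ sq''.pt) (r : sq''.pt ⟶ sq.pt),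
      sq'.π ≫ q = sq''.π ∧ IsPullback sq'.fst q sq.π r := by
  have h₁ (Z : C₃) : (G.map (i ≫ j).op).app Z = (G.map j.op).app Z ≫ (G.map i.op).app Z := by
    rw [op_comp, G.map_comp, NatTrans.comp_app]
  let r : sq''.pt ⟶ sq.pt := sq.isPullback.lift sq''.fst (sq''.snd ≫ (G.map j.op).app Y) (by
    rw [sq''.isPullback.w, h₁, Category.assoc])
  let q : sq'.pt ⟶ sq''.pt :=
    sq''.isPullback.lift (sq'.fst ≫ (G.map i.op).app X) sq'.snd (by
      rw [Category.assoc, ← NatTrans.naturality, sq'.isPullback.w_assoc, h₁])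
  have hr₁ : r ≫ sq.fst = sq''.fst := sq.isPullback.lift_fst ..
  have hr₂ : r ≫ sq.snd = sq''.snd ≫ (G.map j.op).app Y := sq.isPullback.lift_snd ..
  have hq₁ : q ≫ sq''.fst = sq'.fst ≫ (G.map i.op).app X := sq''.isPullback.lift_fst ..
  have hq₂ : q ≫ sq''.snd = sq'.snd := sq''.isPullback.lift_snd ..
  refine ⟨q, r, ?_, ?_⟩
  · apply sq''.isPullback.hom_ext
    · rw [Category.assoc, hq₁, sq'.π_fst_assoc, sq''.π_fst, h₁]
    · rw [Category.assoc, hq₂, sq'.π_snd, sq''.π_snd]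
  · have h₂ : IsPullback r sq''.snd sq.snd ((G.map j.op).app Y) := by
      refine IsPullback.of_right ?_ hr₂ sq.isPullback
      rw [hr₁, ← h₁]
      exact sq''.isPullback
    refine IsPullback.of_bot ?_ ?_ h₂
    · rw [hq₂, sq.π_snd]
      exact sq'.isPullback
    · apply sq.isPullback.hom_ext
      · rw [Category.assoc, Category.assoc, hr₁, hq₁, sq.π_fst]
      · rw [Category.assoc, Category.assoc, hr₂, sq.π_snd, sq'.isPullback.w, reassoc_of% hq₂]

end CategoryTheory.Functor.PullbackObjObj

namespace BiSSet

open MorphismProperty Limits SSet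

/-! ### Lifting against box products of monomorphisms -/

variable {X Y : BiSSet.{u}} (p : X ⟶ Y)

/-- The pullback-hom of `i` and `p` for the bifunctor `homRows`. -/
noncomputable abbrev homRowsSq {A B : SSet.{u}} (i : A ⟶ B) : homRows.PullbackObjObj i p :=
  .ofHasPullback _ _ _

/-- The pullback-hom of `j` and `p` for the bifunctor `homColumns`. -/
noncomputable abbrev homColumnsSq {A B : SSet.{u}} (j : A ⟶ B) : homColumns.PullbackObjObj j p :=
  .ofHasPullback _ _ _

lemma hasLiftingProperty_homColumnsSq_π_iff {A B K L : SSet.{u}} (i : A ⟶ B) (j : K ⟶ L) :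
    HasLiftingProperty i (homColumnsSq p j).π ↔ HasLiftingProperty j (homRowsSq p i).π := by
  let sq := Functor.PushoutObjObj.ofHasPushout boxFunctor i j
  rw [← boxAdjunction.hasLiftingProperty_iff sq,
    ← boxFlipAdjunction.hasLiftingProperty_iff sq.flip]
  rfl

/-- The class of maps `i` whose pullback-hom with `p` is a trivial Kan fibration. Equivalently, `p`
has the right lifting property against the pushout-product, for the box product, of `i` and any
monomorphism. -/
def boxTrivial : MorphismProperty SSet.{u} := fun _ _ i ↦ trivialKanFibrations (homRowsSq p i).π

lemma boxTrivial_eq_llp :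
    boxTrivial p = (MorphismProperty.ofHoms fun j : Σ (K L : SSet.{u}), {j : K ⟶ L // Mono j} ↦
      (homColumnsSq p j.2.2.1).π).llp := by
  ext A B i
  constructor
  · rintro hi _ _ _ ⟨K, L, j, hj⟩
    rw [hasLiftingProperty_homColumnsSq_π_iff]
    rw [boxTrivial, trivialKanFibrations_eq_rlp] at hi
    exact hi _ hj
  · intro hi
    rw [boxTrivial, trivialKanFibrations_eq_rlp]
    intro K L j hj
    rw [← hasLiftingProperty_homColumnsSq_π_iff]
    exact hi _ (MorphismProperty.ofHoms.mk (f := fun j : Σ (K L : SSet.{u}),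
      {j : K ⟶ L // Mono j} ↦ (homColumnsSq p j.2.2.1).π) ⟨K, L, j, hj⟩)

instance : (boxTrivial p).IsMultiplicative := by
  rw [boxTrivial_eq_llp]
  infer_instance

instance : (boxTrivial p).IsStableUnderCobaseChange := by
  rw [boxTrivial_eq_llp]
  infer_instance

variable {p}

lemma boxTrivial.hasLiftingProperty {A B K L : SSet.{u}} {i : A ⟶ B} (hi : boxTrivial p i)
    (j : K ⟶ L) [Mono j] (sq : boxFunctor.PushoutObjObj i j) : HasLiftingProperty sq.ι p := by
  rw [boxAdjunction.hasLiftingProperty_iff sq (homRowsSq p i)]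
  rw [boxTrivial, trivialKanFibrations_eq_rlp] at hi
  exact hi _ (.infer_property _)

/-- The pushout-product, for the box product, of the inclusions of two subcomplexes. -/
def boxUnionSq {K L : SSet.{u}} (A : K.Subcomplex) (B : L.Subcomplex) :
    boxFunctor.PushoutObjObj A.ι B.ι where
  pt := (boxUnion A B).toFunctor
  inl := { app _ := ↾fun x ↦ ⟨(x.1, x.2.1), Or.inr ⟨trivial, x.2.2⟩⟩ }
  inr := { app _ := ↾fun x ↦ ⟨(x.1.1, x.2), Or.inl ⟨x.1.2, trivial⟩⟩ }
  isPushout := by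
    have h : Lattice.BicartSq (boxSub A B) (boxSub ⊤ B) (boxSub A ⊤) (boxUnion A B) :=
      { sup_eq := sup_comm _ _
        inf_eq := by
          ext U x
          exact ⟨fun h ↦ ⟨h.2.1, h.1.2⟩, fun h ↦ ⟨⟨trivial, h.2⟩, ⟨h.1, trivial⟩⟩⟩ }
    refine (Subfunctor.isPushout_of_bicartSq h).of_iso
      (NatIso.ofComponents fun a ↦ Equiv.toIso
        { toFun x := (⟨x.1.1, x.2.1⟩, ⟨x.1.2, x.2.2⟩)
          invFun x := ⟨(x.1.1, x.2.1), x.1.2, x.2.2⟩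
          left_inv _ := rfl
          right_inv _ := rfl })
      (NatIso.ofComponents fun a ↦ Equiv.toIso
        { toFun x := (x.1.1, ⟨x.1.2, x.2.2⟩)
          invFun x := ⟨(x.1, x.2.1), trivial, x.2.2⟩
          left_inv _ := rfl
          right_inv _ := rfl })
      (NatIso.ofComponents fun a ↦ Equiv.toIso
        { toFun x := (⟨x.1.1, x.2.1⟩, x.1.2)
          invFun x := ⟨(x.1.1, x.2), x.1.2, trivial⟩
          left_inv _ := rfl
          right_inv _ := rfl })
      (Iso.refl _) rfl rfl rfl rfl
  ι := (boxUnion A B).ι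

lemma boxTrivial.boxUnion_ι {K L : SSet.{u}} {A : K.Subcomplex} (hA : boxTrivial p A.ι)
    (B : L.Subcomplex) : HasLiftingProperty (boxUnion A B).ι p :=
  have : Mono B.ι := inferInstanceAs (Mono (Subfunctor.ι _))
  hA.hasLiftingProperty _ (boxUnionSq A B)

/-- The pullback-hom of a monomorphism and a horizontal Reedy left fibration is a left fibration. -/
lemma leftFibrations_homRowsSq_π (hp : horizontalReedyLeftFibrations p) {A B : SSet.{u}}
    (i : A ⟶ B) [Mono i] : leftFibrations (homRowsSq p i).π := by
  rw [leftFibrations_eq_rlp]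
  rintro _ _ _ ⟨k, hn, hk⟩
  rw [← hasLiftingProperty_homColumnsSq_π_iff]
  suffices (MorphismProperty.monomorphisms _).rlp (homColumnsSq p Λ[_, k].ι).π from
    this _ (.infer_property _)
  rw [← trivialKanFibrations_eq_rlp]
  rintro _ _ _ ⟨m⟩
  rw [hasLiftingProperty_homColumnsSq_π_iff,
    ← boxAdjunction.hasLiftingProperty_iff (boxUnionSq _ _)]
  exact hp _ ⟨m, k, hn, hk⟩

lemma hasLiftingProperty_boxUnion_ι (hp : horizontalReedyLeftFibrations p)
    {K L : SSet.{u}} (A : K.Subcomplex) {B : L.Subcomplex} (hB : leftAnodyneMaps B.ι) :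
    HasLiftingProperty (boxUnion A B).ι p := by
  have : Mono A.ι := inferInstanceAs (Mono (Subfunctor.ι _))
  have := leftFibrations_homRowsSq_π hp A.ι _ hB
  rwa [← boxAdjunction.hasLiftingProperty_iff (boxUnionSq _ _)] at this

/-- If `p` is a horizontal Reedy left fibration, the class `boxTrivial p` has right cancellation:
the pullback-hom of `j` is then a left fibration, whose composition with a trivial Kan fibration is
a trivial Kan fibration. -/
lemma boxTrivial_of_precomp (hp : horizontalReedyLeftFibrations p) {A B C : SSet.{u}} (i : A ⟶ B)
    (j : B ⟶ C) [Mono j] (hi : boxTrivial p i) (hij : boxTrivial p (i ≫ j)) : boxTrivial p j := by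
  obtain ⟨q, r, fac, sq⟩ := (homRowsSq p i).exists_π_comp_eq (homRowsSq p j) (homRowsSq p (i ≫ j))
  refine trivialKanFibrations_of_postcomp (q := q) (leftFibrations_homRowsSq_π hp j) ?_ ?_
  · exact MorphismProperty.of_isPullback (P := modelCategoryQuillen.I.rlp) sq hi
  · rw [fac]
    exact hij

/-- Evaluation at the universal simplex identifies `homRows Δ[n] X` with the `n`-th column. -/
def homRowsStdSimplexIso (n : ℕ) (X : BiSSet.{u}) :
    (homRows.obj (op Δ[n])).obj X ≅ (column n).obj X :=
  NatIso.ofComponents (fun k ↦ Equiv.toIso (yonedaEquiv (X := (rows.obj X).obj k))) (fun _ ↦ rfl)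

lemma homRowsStdSimplexIso_naturality (n : ℕ) {X Y : BiSSet.{u}} (p : X ⟶ Y) :
    (homRows.obj (op Δ[n])).map p ≫ (homRowsStdSimplexIso n Y).hom =
      (homRowsStdSimplexIso n X).hom ≫ (column n).map p := rfl

lemma homRowsStdSimplexIso_naturality' {m n : ℕ} (α : ⦋m⦌ ⟶ ⦋n⦌) (X : BiSSet.{u}) :
    (homRows.map (stdSimplex.{u}.map α).op).app X ≫ (homRowsStdSimplexIso m X).hom =
      (homRowsStdSimplexIso n X).hom ≫ (columnMap α).app X := by
  refine NatTrans.ext (funext fun k ↦ ?_)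
  ext φ
  exact (SSet.yonedaEquiv_naturality (X := (rows.obj X).obj k) α φ).symm

/-- For the inclusion of the initial vertex of `Δ[n]`, the pullback-hom with `p` is the map
`initialVertexMap p n`. -/
lemma boxTrivial_initial_vertex (hp : IsStrongHorizontalReedyLeftFibration p) (n : ℕ) :
    boxTrivial p (stdSimplex.{u}.map (SimplexCategory.const ⦋0⦌ ⦋n⦌ 0)) := by
  let α := SimplexCategory.const ⦋0⦌ ⦋n⦌ 0
  let e : (homRowsSq p (stdSimplex.{u}.map α)).pt ≅
      Limits.pullback ((column 0).map p) ((columnMap α).app Y) :=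
    @asIso _ _ _ _ (pullback.map _ _ _ _ (homRowsStdSimplexIso 0 X).hom
      (homRowsStdSimplexIso n Y).hom (homRowsStdSimplexIso 0 Y).hom
      (homRowsStdSimplexIso_naturality 0 p) (homRowsStdSimplexIso_naturality' α Y))
      (pullback.map_isIso ..)
  have e₁ : e.hom ≫ pullback.fst _ _ = (homRowsSq p (stdSimplex.{u}.map α)).fst ≫
      (homRowsStdSimplexIso 0 X).hom := pullback.lift_fst ..
  have e₂ : e.hom ≫ pullback.snd _ _ = (homRowsSq p (stdSimplex.{u}.map α)).snd ≫
      (homRowsStdSimplexIso n Y).hom := pullback.lift_snd ..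
  have h₁ : initialVertexMap p n ≫ pullback.fst _ _ = (columnMap α).app X := pullback.lift_fst ..
  have h₂ : initialVertexMap p n ≫ pullback.snd _ _ = (column n).map p := pullback.lift_snd ..
  have w : (homRowsStdSimplexIso n X).hom ≫ initialVertexMap p n =
      (homRowsSq p (stdSimplex.{u}.map α)).π ≫ e.hom := by
    apply pullback.hom_ext
    · refine (Category.assoc ..).trans (Eq.trans ?_ (Category.assoc ..).symm)
      refine (congr_arg _ h₁).trans (Eq.trans ?_ (congr_arg _ e₁).symm)
      refine (homRowsStdSimplexIso_naturality' α X).symm.trans ?_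
      exact (congr_arg (· ≫ _) (homRowsSq p (stdSimplex.{u}.map α)).π_fst).symm.trans
        (Category.assoc ..)
    · refine (Category.assoc ..).trans (Eq.trans ?_ (Category.assoc ..).symm)
      refine (congr_arg _ h₂).trans (Eq.trans ?_ (congr_arg _ e₂).symm)
      refine (homRowsStdSimplexIso_naturality n p).symm.trans ?_
      exact (congr_arg (· ≫ _) (homRowsSq p (stdSimplex.{u}.map α)).π_snd).symm.trans
        (Category.assoc ..)
  exact (MorphismProperty.arrow_mk_iso_iff modelCategoryQuillen.I.rlp
    (CategoryTheory.Arrow.isoMk (homRowsStdSimplexIso n X) e w)).2 (hp.trivialKanFibration n)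

end BiSSet

namespace BiSSet

open MorphismProperty Limits SSet SSet.stdSimplex

/-! ### Lifting properties of diagonals -/

variable {X Y : BiSSet.{u}}

/-- The simplicial map `Δ[n] ⟶ dX` obtained by restricting to the diagonal simplices a map
`Δ[n] □ Δ[n] ⟶ X`. -/
def diagonalRestriction {n : ℕ} (G : box Δ[n] Δ[n] ⟶ X) : Δ[n] ⟶ diagonal.obj X where
  app a := ↾fun x ↦ G.app (a, a) ((x, x) : (box Δ[n] Δ[n]).obj (a, a))
  naturality _ _ α := by
    ext x
    exact NatTrans.naturality_apply G (Prod.mkHom α α) ((x, x) : (box Δ[n] Δ[n]).obj (_, _))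

lemma map_objEquiv_id {n : ℕ} {a : SimplexCategoryᵒᵖ} (x : (Δ[n] : SSet.{u}).obj a) :
    (Δ[n] : SSet.{u}).map (objEquiv x).op (objEquiv.symm (𝟙 ⦋n⦌)) = x :=
  objEquiv.injective (Category.comp_id (objEquiv x))

lemma exists_diagonalRestriction_eq {n : ℕ} (g : Δ[n] ⟶ diagonal.obj X) :
    ∃ G, diagonalRestriction G = g := by
  let z : X.obj (op ⦋n⦌, op ⦋n⦌) := g.app (op ⦋n⦌) (objEquiv.symm (𝟙 ⦋n⦌))
  refine ⟨{ app a := ↾fun x ↦ X.map (Prod.mkHom (objEquiv x.1).op (objEquiv x.2).op) z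
            naturality a b f := ?_ }, ?_⟩
  · ext ⟨x, y⟩
    refine Eq.trans ?_ (X.map_comp_apply _ _ _)
    rfl
  · refine NatTrans.ext (funext fun a ↦ ?_)
    ext x
    refine (NatTrans.naturality_apply g (objEquiv x).op (objEquiv.symm (𝟙 ⦋n⦌))).symm.trans ?_
    exact congr_arg (fun x ↦ g.app a x) (map_objEquiv_id x)

/-- The bisimplicial subset of `Δ[n] □ Δ[n]` consisting of the pairs of simplices for which some
element of `V` is a vertex of neither component. -/
def diagonalHorn {n : ℕ} (V : Finset (Fin (n + 1))) : Subfunctor (box Δ[n] Δ[n] : BiSSet.{u}) where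
  obj _ := {x | ¬ V ⊆ support x.1 ∪ support x.2}
  map f x hx h := hx (h.trans
    (Finset.union_subset_union (support_map_subset f.1 x.1) (support_map_subset f.2 x.2)))

lemma exists_map_eq_of_support_subset {n : ℕ} {a b : SimplexCategoryᵒᵖ}
    {e : (Δ[n] : SSet.{u}).obj a} (he : Function.Injective (asOrderHom e))
    {x : (Δ[n] : SSet.{u}).obj b} (h : support x ⊆ support e) :
    ∃ f : a ⟶ b, (Δ[n] : SSet.{u}).map f e = x := by
  obtain ⟨y, hy⟩ := (mem_range_map_iff (n := n) (m := a.unop.len) (objEquiv e) he x).2 h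
  refine ⟨(objEquiv y).op, ?_⟩
  rw [← hy]
  rfl

lemma map_injective_of_injective {n : ℕ} {a b : SimplexCategoryᵒᵖ}
    {e : (Δ[n] : SSet.{u}).obj a} (he : Function.Injective (asOrderHom e)) (f g : a ⟶ b)
    (h : (Δ[n] : SSet.{u}).map f e = (Δ[n] : SSet.{u}).map g e) : f = g := by
  apply Quiver.Hom.unop_inj
  ext i : 3
  exact he (congr_arg (fun z ↦ asOrderHom z i) h)

lemma exists_injective_simplex {n : ℕ} {T : Finset (Fin (n + 1))} (hT : T.Nonempty) :
    ∃ (a : SimplexCategoryᵒᵖ) (e : (Δ[n] : SSet.{u}).obj a),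
      Function.Injective (asOrderHom e) ∧ support e = T := by
  obtain ⟨t, e, he, he'⟩ := exists_face T hT
  exact ⟨op ⦋t⦌, objEquiv.symm e, he, he'⟩

/-- The components of a pair of simplices of `Δ[n]` factor through the face spanned by their
vertices. -/
lemma exists_face_of_pair {n : ℕ} {b c : SimplexCategoryᵒᵖ} (x : (Δ[n] : SSet.{u}).obj b)
    (y : (Δ[n] : SSet.{u}).obj c) :
    ∃ (a : SimplexCategoryᵒᵖ) (e : (Δ[n] : SSet.{u}).obj a) (f : a ⟶ b) (g : a ⟶ c),
      Function.Injective (asOrderHom e) ∧ support e = support x ∪ support y ∧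
        (Δ[n] : SSet.{u}).map f e = x ∧ (Δ[n] : SSet.{u}).map g e = y := by
  obtain ⟨a, e, he, he'⟩ := exists_injective_simplex.{u}
    ((support_nonempty x).mono (Finset.subset_union_left (s₂ := support y)))
  obtain ⟨f, hf⟩ := exists_map_eq_of_support_subset he
    (Finset.subset_union_left.trans he'.symm.subset)
  obtain ⟨g, hg⟩ := exists_map_eq_of_support_subset he
    (Finset.subset_union_right.trans he'.symm.subset)
  exact ⟨a, e, f, g, he, he', hf, hg⟩

section

variable {n : ℕ} {V : Finset (Fin (n + 1))}
  (f : (generalizedHorn.{u} V : SSet) ⟶ diagonal.obj X)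

/-- The element of `X` obtained by applying `f` to a face through which a pair of simplices factors
does not depend on the face. -/
lemma map_app_eq_of_support_subset {a₁ a₂ b c : SimplexCategoryᵒᵖ}
    {e₁ : (Δ[n] : SSet.{u}).obj a₁} {e₂ : (Δ[n] : SSet.{u}).obj a₂}
    (h₁ : e₁ ∈ (generalizedHorn V).obj a₁) (h₂ : e₂ ∈ (generalizedHorn V).obj a₂)
    (he₂ : Function.Injective (asOrderHom e₂)) (h : support e₁ ⊆ support e₂)
    {x₁ : a₁ ⟶ b} {x₂ : a₂ ⟶ b} (hx : (Δ[n] : SSet.{u}).map x₁ e₁ = (Δ[n] : SSet.{u}).map x₂ e₂)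
    {y₁ : a₁ ⟶ c} {y₂ : a₂ ⟶ c} (hy : (Δ[n] : SSet.{u}).map y₁ e₁ = (Δ[n] : SSet.{u}).map y₂ e₂) :
    X.map (Prod.mkHom x₁ y₁) (f.app a₁ ⟨e₁, h₁⟩) =
      X.map (Prod.mkHom x₂ y₂) (f.app a₂ ⟨e₂, h₂⟩) := by
  obtain ⟨g, rfl⟩ := exists_map_eq_of_support_subset he₂ h
  obtain rfl : g ≫ x₁ = x₂ := map_injective_of_injective he₂ _ _
    (((Δ[n] : SSet.{u}).map_comp_apply _ _ _).trans hx)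
  obtain rfl : g ≫ y₁ = y₂ := map_injective_of_injective he₂ _ _
    (((Δ[n] : SSet.{u}).map_comp_apply _ _ _).trans hy)
  refine (congr_arg (fun z ↦ X.map (Prod.mkHom x₁ y₁) z)
    (NatTrans.naturality_apply f g ⟨e₂, h₂⟩)).trans ?_
  exact (X.map_comp_apply (Prod.mkHom g g) (Prod.mkHom x₁ y₁) _).symm

/-- A map from a generalized horn to `dX` extends to a map from the corresponding bisimplicial
subset of `Δ[n] □ Δ[n]`: both components of an element of the latter factor uniquely through the
face spanned by their vertices, which belongs to the generalized horn. -/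
lemma exists_diagonalHorn_extension :
    ∃ F : (diagonalHorn.{u} V).toFunctor ⟶ X,
      ∀ ⦃a b c : SimplexCategoryᵒᵖ⦄ (e : (Δ[n] : SSet.{u}).obj a)
        (_ : Function.Injective (asOrderHom e)) (he' : e ∈ (generalizedHorn V).obj a)
        (x : a ⟶ b) (y : a ⟶ c) (h : ((Δ[n] : SSet.{u}).map x e, (Δ[n] : SSet.{u}).map y e) ∈
          (diagonalHorn V).obj (b, c)),
        F.app (b, c) ⟨_, h⟩ = X.map (Prod.mkHom x y) (f.app a ⟨e, he'⟩) := by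
  have key (a : SimplexCategoryᵒᵖ × SimplexCategoryᵒᵖ) (z : (diagonalHorn.{u} V).obj a) :=
    exists_face_of_pair z.1.1 z.1.2
  choose b e x y he hs hx hy using key
  have hmem (a) (z : (diagonalHorn.{u} V).obj a) : e a z ∈ (generalizedHorn V).obj _ := by
    rw [mem_generalizedHorn, hs]
    exact z.2
  refine ⟨{ app a := ↾fun z ↦ X.map (Prod.mkHom (x a z) (y a z)) (f.app _ ⟨e a z, hmem a z⟩)
            naturality a a' α := ?_ }, ?_⟩
  · ext z
    refine Eq.trans ?_ (X.map_comp_apply (Prod.mkHom (x a z) (y a z)) α _)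
    refine map_app_eq_of_support_subset f _ _ (he a z) ?_ ?_ ?_
    · refine (hs _ _).subset.trans (subset_trans ?_ (hs _ _).symm.subset)
      exact Finset.union_subset_union (support_map_subset α.1 z.1.1) (support_map_subset α.2 z.1.2)
    · refine (hx _ _).trans (Eq.trans ?_ ((Δ[n] : SSet.{u}).map_comp_apply _ _ _).symm)
      exact congr_arg (fun z ↦ (Δ[n] : SSet.{u}).map α.1 z) (hx a z).symm
    · refine (hy _ _).trans (Eq.trans ?_ ((Δ[n] : SSet.{u}).map_comp_apply _ _ _).symm)
      exact congr_arg (fun z ↦ (Δ[n] : SSet.{u}).map α.2 z) (hy a z).symm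
  · intro a b c e' he' hmem' x' y' h
    refine map_app_eq_of_support_subset f _ _ he' ?_ (hx _ _) (hy _ _)
    rw [hs]
    exact Finset.union_subset (support_map_subset x' e') (support_map_subset y' e')

end

/-- Lifting properties of `dp` against generalized horns follow from lifting properties of `p`. -/
lemma hasLiftingProperty_diagonal_map {n : ℕ} (V : Finset (Fin (n + 1))) {p : X ⟶ Y}
    (hp : HasLiftingProperty (diagonalHorn.{u} V).ι p) :
    HasLiftingProperty (generalizedHorn.{u} V).ι (diagonal.map p) where
  sq_hasLift {f g} sq := by
    obtain ⟨G, rfl⟩ := exists_diagonalRestriction_eq g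
    obtain ⟨F, hF⟩ := exists_diagonalHorn_extension f
    have sq' : CommSq F (diagonalHorn.{u} V).ι p G := ⟨by
      refine NatTrans.ext (funext fun ⟨a, b⟩ ↦ ?_)
      ext ⟨z, hz⟩
      obtain ⟨x, y⟩ := z
      obtain ⟨c, e, x, y, he, hs, rfl, rfl⟩ := exists_face_of_pair x y
      have he' : e ∈ (generalizedHorn.{u} V).obj c := by
        rw [mem_generalizedHorn, hs]
        exact hz
      have h₁ := NatTrans.naturality_apply p (Prod.mkHom x y) (f.app c ⟨e, he'⟩)
      have h₂ : p.app (c, c) (f.app c ⟨e, he'⟩) =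
          G.app (c, c) ((e, e) : (box Δ[n] Δ[n]).obj (c, c)) :=
        congr_arg (fun φ ↦ φ.app c ⟨e, he'⟩) sq.w
      have h₃ := NatTrans.naturality_apply G (Prod.mkHom x y) ((e, e) : (box Δ[n] Δ[n]).obj (c, c))
      refine (congr_arg (fun z ↦ p.app (a, b) z) (hF e he he' x y hz)).trans (h₁.trans ?_)
      exact (congr_arg (fun z ↦ Y.map (Prod.mkHom x y) z) h₂).trans h₃.symm⟩
    refine ⟨⟨⟨diagonalRestriction sq'.lift, ?_, ?_⟩⟩⟩
    · refine NatTrans.ext (funext fun a ↦ ?_)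
      ext ⟨x, hx⟩
      have hxx : ((x, x) : (box Δ[n] Δ[n]).obj (a, a)) ∈ (diagonalHorn.{u} V).obj (a, a) := by
        change ¬ V ⊆ support x ∪ support x
        rwa [Finset.union_idempotent]
      refine (congr_arg (fun φ ↦ φ.app (a, a) ⟨_, hxx⟩) sq'.fac_left).trans ?_
      obtain ⟨b, e, he, he'⟩ := exists_injective_simplex.{u} (support_nonempty x)
      obtain ⟨g, rfl⟩ := exists_map_eq_of_support_subset he he'.symm.subset
      refine (hF e he (by rwa [mem_generalizedHorn, he']) g g hxx).trans ?_
      exact (NatTrans.naturality_apply f g ⟨e, _⟩).symm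
    · refine NatTrans.ext (funext fun a ↦ ?_)
      ext x
      exact congr_arg (fun φ ↦ φ.app (a, a) ((x, x) : (box Δ[n] Δ[n]).obj (a, a))) sq'.fac_right

end BiSSet

namespace BiSSet

open MorphismProperty Limits SSet SSet.stdSimplex

/-! ### Filtrations of `Δ[m] □ Δ[n]` by vertices -/

variable (W : MorphismProperty BiSSet.{u}) [W.IsMultiplicative] [W.IsStableUnderCobaseChange]
  {m n : ℕ}

/-- The vertices of the horizontal component of an element of `Δ[m] □ Δ[n]`. -/
def supportFst ⦃a : SimplexCategoryᵒᵖ × SimplexCategoryᵒᵖ⦄ (x : (box.{u} Δ[m] Δ[n]).obj a) :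
    Finset (Fin (m + 1)) := support x.1

/-- The vertices of the vertical component of an element of `Δ[m] □ Δ[n]`. -/
def supportSnd ⦃a : SimplexCategoryᵒᵖ × SimplexCategoryᵒᵖ⦄ (x : (box.{u} Δ[m] Δ[n]).obj a) :
    Finset (Fin (n + 1)) := support x.2

lemma supportFst_map_subset ⦃a b : SimplexCategoryᵒᵖ × SimplexCategoryᵒᵖ⦄ (f : a ⟶ b)
    (x : (box.{u} Δ[m] Δ[n]).obj a) : supportFst ((box Δ[m] Δ[n]).map f x) ⊆ supportFst x :=
  support_map_subset f.1 x.1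

lemma supportSnd_map_subset ⦃a b : SimplexCategoryᵒᵖ × SimplexCategoryᵒᵖ⦄ (f : a ⟶ b)
    (x : (box.{u} Δ[m] Δ[n]).obj a) : supportSnd ((box Δ[m] Δ[n]).map f x) ⊆ supportSnd x :=
  support_map_subset f.2 x.2

lemma mem_boundary_iff_support_ne_univ {a : SimplexCategoryᵒᵖ} (x : (Δ[n] : SSet.{u}).obj a) :
    x ∈ (∂Δ[n] : Subcomplex.{u} _).obj a ↔ support x ≠ Finset.univ := by
  rw [← generalizedHorn_univ, mem_generalizedHorn, Finset.univ_subset_iff]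

lemma support_map_app_ssubset_iff {t : ℕ} {e : ⦋t⦌ ⟶ ⦋n⦌} (he : Function.Injective e.toOrderHom)
    {a : SimplexCategoryᵒᵖ} (x : (Δ[t] : SSet.{u}).obj a) :
    support ((stdSimplex.{u}.map e).app a x) < Finset.univ.image e.toOrderHom ↔
      x ∈ (∂Δ[t] : Subcomplex.{u} _).obj a := by
  rw [mem_boundary_iff_support_ne_univ]
  refine (iff_of_eq (congr_arg (· < _) (support_map_app e x))).trans ?_
  rw [Finset.image_ssubset_image he, Finset.ssubset_univ_iff]

lemma mono_boxFunctor_obj_map (K : SSet.{u}) {L L' : SSet.{u}} (g : L ⟶ L') [Mono g] :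
    Mono ((boxFunctor.obj K).map g) := by
  have (a : SimplexCategoryᵒᵖ × SimplexCategoryᵒᵖ) : Mono (((boxFunctor.obj K).map g).app a) := by
    have h := (mono_iff_injective (g.app a.2)).1 inferInstance
    rw [mono_iff_injective]
    rintro ⟨x, y⟩ ⟨x', y'⟩ hx
    obtain ⟨h₁, h₂⟩ := Prod.mk.inj hx
    exact Prod.ext h₁ (h h₂)
  exact NatTrans.mono_of_mono_app _

lemma mono_boxFunctor_map_app {K K' : SSet.{u}} (f : K ⟶ K') [Mono f] (L : SSet.{u}) :
    Mono ((boxFunctor.map f).app L) := by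
  have (a : SimplexCategoryᵒᵖ × SimplexCategoryᵒᵖ) : Mono (((boxFunctor.map f).app L).app a) := by
    have h := (mono_iff_injective (f.app a.1)).1 inferInstance
    rw [mono_iff_injective]
    rintro ⟨x, y⟩ ⟨x', y'⟩ hx
    obtain ⟨h₁, h₂⟩ := Prod.mk.inj hx
    exact Prod.ext (h h₁) h₂
  exact NatTrans.mono_of_mono_app _

lemma mem_range_boxFunctor_obj_map_iff {K L L' : SSet.{u}} (g : L ⟶ L')
    {a : SimplexCategoryᵒᵖ × SimplexCategoryᵒᵖ} (x : (box K L').obj a) :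
    x ∈ (Subfunctor.range ((boxFunctor.obj K).map g)).obj a ↔
      x.2 ∈ (Subfunctor.range g).obj a.2 := by
  constructor
  · rintro ⟨y, rfl⟩
    exact ⟨y.2, rfl⟩
  · rintro ⟨y, hy⟩
    exact ⟨(x.1, y), congr_arg (Prod.mk x.1) hy⟩

lemma mem_range_boxFunctor_map_app_iff {K K' L : SSet.{u}} (f : K ⟶ K')
    {a : SimplexCategoryᵒᵖ × SimplexCategoryᵒᵖ} (x : (box K' L).obj a) :
    x ∈ (Subfunctor.range ((boxFunctor.map f).app L)).obj a ↔
      x.1 ∈ (Subfunctor.range f).obj a.1 := by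
  constructor
  · rintro ⟨y, rfl⟩
    exact ⟨y.1, rfl⟩
  · rintro ⟨y, hy⟩
    exact ⟨(y, x.2), congr_arg (Prod.mk · x.2) hy⟩

/-- A bisimplicial subset `D` of `Δ[m] □ Δ[n]` whose elements with given vertical support `T` are
determined by a subcomplex `A T` of `Δ[m]` can be enlarged by attaching maps which are
pushout-products of `A T ⟶ Δ[m]` and of boundary inclusions. -/
lemma homOfLe_sup_suppIn_supportSnd (D : Subfunctor (box.{u} Δ[m] Δ[n]))
    (𝒰 : LowerSet (Finset (Fin (n + 1)))) (A : Finset (Fin (n + 1)) → (Δ[m] : SSet.{u}).Subcomplex)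
    (hA : ∀ ⦃a⦄ (x : (box.{u} Δ[m] Δ[n]).obj a), x ∈ D.obj a ↔ x.1 ∈ (A (support x.2)).obj a.1)
    (hW : ∀ T ∈ 𝒰, ∀ t, W (boxUnion (A T) (∂Δ[t] : Subcomplex _)).ι) :
    W (Subfunctor.homOfLe (le_sup_left :
      D ≤ D ⊔ Subfunctor.suppIn supportSnd supportSnd_map_subset 𝒰)) := by
  refine Subfunctor.homOfLe_sup_suppIn W supportSnd supportSnd_map_subset
    (fun a x ↦ support_nonempty x.2) D 𝒰 fun T hT hT' ↦ ?_
  obtain ⟨t, e, he, rfl⟩ := exists_face T hT'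
  have := mono_map.{u} e he
  refine ⟨_, (boxFunctor.obj Δ[m]).map (stdSimplex.{u}.map e), mono_boxFunctor_obj_map _ _, ?_, ?_⟩
  · ext a x
    exact (mem_range_boxFunctor_obj_map_iff _ x).trans (mem_range_map_iff e he x.2)
  · refine (congr_arg (fun D : Subfunctor (box Δ[m] Δ[t]) ↦ W D.ι) ?_).mpr (hW _ hT t)
    · ext a x
      have h₁ := hA (((boxFunctor.obj Δ[m]).map (stdSimplex.{u}.map e)).app a x)
      have h₂ := support_map_app_ssubset_iff he x.2
      change _ ∨ support ((stdSimplex.{u}.map e).app a.2 x.2) < _ ↔ (_ ∧ True) ∨ (True ∧ _)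
      rw [h₂, and_true, true_and]
      refine or_congr_left' fun h₃ ↦ h₁.trans ?_
      have h₄ : support x.2 = Finset.univ := by
        rwa [mem_boundary_iff_support_ne_univ, not_not] at h₃
      have h₅ : support ((stdSimplex.{u}.map e).app a.2 x.2) = Finset.univ.image e.toOrderHom := by
        refine (support_map_app e x.2).trans ?_
        rw [h₄]
      exact iff_of_eq (congr_arg (fun S ↦ x.1 ∈ (A S).obj a.1) h₅)

/-- The variant of `homOfLe_sup_suppIn_supportSnd` for the horizontal supports. -/
lemma homOfLe_sup_suppIn_supportFst (D : Subfunctor (box.{u} Δ[m] Δ[n]))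
    (𝒰 : LowerSet (Finset (Fin (m + 1)))) (B : Finset (Fin (m + 1)) → (Δ[n] : SSet.{u}).Subcomplex)
    (hB : ∀ ⦃a⦄ (x : (box.{u} Δ[m] Δ[n]).obj a), x ∈ D.obj a ↔ x.2 ∈ (B (support x.1)).obj a.2)
    (hW : ∀ S ∈ 𝒰, ∀ s, W (boxUnion (∂Δ[s] : Subcomplex _) (B S)).ι) :
    W (Subfunctor.homOfLe (le_sup_left :
      D ≤ D ⊔ Subfunctor.suppIn supportFst supportFst_map_subset 𝒰)) := by
  refine Subfunctor.homOfLe_sup_suppIn W supportFst supportFst_map_subset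
    (fun a x ↦ support_nonempty x.1) D 𝒰 fun S hS hS' ↦ ?_
  obtain ⟨s, e, he, rfl⟩ := exists_face S hS'
  have := mono_map.{u} e he
  refine ⟨_, (boxFunctor.map (stdSimplex.{u}.map e)).app Δ[n], mono_boxFunctor_map_app _ _, ?_, ?_⟩
  · ext a x
    exact (mem_range_boxFunctor_map_app_iff _ x).trans (mem_range_map_iff e he x.1)
  · refine (congr_arg (fun D : Subfunctor (box Δ[s] Δ[n]) ↦ W D.ι) ?_).mpr (hW _ hS s)
    · ext a x
      have h₁ := hB (((boxFunctor.map (stdSimplex.{u}.map e)).app Δ[n]).app a x)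
      have h₂ := support_map_app_ssubset_iff he x.1
      change _ ∨ support ((stdSimplex.{u}.map e).app a.1 x.1) < _ ↔ (_ ∧ True) ∨ (True ∧ _)
      rw [h₂, and_true, true_and, or_comm]
      refine or_congr_right' fun h₃ ↦ h₁.trans ?_
      have h₄ : support x.1 = Finset.univ := by
        rwa [mem_boundary_iff_support_ne_univ, not_not] at h₃
      have h₅ : support ((stdSimplex.{u}.map e).app a.1 x.1) = Finset.univ.image e.toOrderHom := by
        refine (support_map_app e x.1).trans ?_
        rw [h₄]
      exact iff_of_eq (congr_arg (fun S ↦ x.2 ∈ (B S).obj a.2) h₅)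

lemma mem_diagonalHorn_iff_fst_mem {V : Finset (Fin (n + 1))}
    {a : SimplexCategoryᵒᵖ × SimplexCategoryᵒᵖ} (x : (box.{u} Δ[n] Δ[n]).obj a) :
    x ∈ (diagonalHorn V).obj a ↔ x.1 ∈ (generalizedHorn (V \ support x.2)).obj a.1 :=
  not_congr ((iff_of_eq (congr_arg (V ⊆ ·) (Finset.union_comm _ _))).trans sdiff_le_iff.symm)

lemma mem_diagonalHorn_iff_snd_mem {V : Finset (Fin (n + 1))}
    {a : SimplexCategoryᵒᵖ × SimplexCategoryᵒᵖ} (x : (box.{u} Δ[n] Δ[n]).obj a) :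
    x ∈ (diagonalHorn V).obj a ↔ x.2 ∈ (generalizedHorn (V \ support x.1)).obj a.2 :=
  not_congr sdiff_le_iff.symm

/-! ### The diagonal of a strong horizontal Reedy left fibration -/

variable {X Y : BiSSet.{u}} {p : X ⟶ Y}

lemma sup_suppIn_top {F : BiSSet.{u}} {α : Type*} (supp : ∀ ⦃a⦄, F.obj a → Finset α)
    (hsupp : ∀ ⦃a b⦄ (f : a ⟶ b) (x : F.obj a), supp (F.map f x) ⊆ supp x) (D : Subfunctor F) :
    D ⊔ Subfunctor.suppIn supp hsupp ⊤ = ⊤ :=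
  top_le_iff.1 (le_sup_of_le_right fun _ x _ ↦ LowerSet.mem_top (a := supp x))

lemma ι_mem_of_eq_top {D D' : Subfunctor (box.{u} Δ[m] Δ[n])} (h : D ≤ D') (hD : D' = ⊤)
    (hW : W (Subfunctor.homOfLe h)) : W D.ι := by
  subst hD
  exact W.comp_mem _ (Subfunctor.ι ⊤) hW (W.of_isIso _)

/-- The diagonal of a strong horizontal Reedy left fibration `p` is a left fibration: for
`V = {k}ᶜ`, the inclusion of `diagonalHorn V` is a composition of two maps which have the left
lifting property with respect to `p`. The first one attaches the elements whose vertical component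
misses the last vertex, and it uses that `p` is strong. The second one attaches the other elements,
and it uses the lifting property of `p` with respect to left anodyne maps in the vertical
direction. -/
lemma leftFibrations_diagonal_map (hp : IsStrongHorizontalReedyLeftFibration p) :
    leftFibrations (diagonal.map p) := by
  rw [leftFibrations_eq_rlp]
  rintro _ _ _ ⟨k, hn, hk⟩
  rename_i n
  rw [← generalizedHorn_compl_singleton]
  apply hasLiftingProperty_diagonal_map
  let W : MorphismProperty BiSSet.{u} := (MorphismProperty.ofHoms fun _ : Unit ↦ p).llp
  have hW {A B : BiSSet.{u}} (i : A ⟶ B) : W i ↔ HasLiftingProperty i p :=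
    ⟨fun h ↦ h _ ⟨()⟩, by rintro h _ _ _ ⟨⟩; exact h⟩
  rw [← hW]
  let 𝒰 : LowerSet (Finset (Fin (n + 1))) := ⟨{T | Fin.last n ∉ T}, fun S T h hS hT ↦ hS (h hT)⟩
  have h₁ : W (Subfunctor.homOfLe (le_sup_left : diagonalHorn {k}ᶜ ≤ diagonalHorn {k}ᶜ ⊔
      Subfunctor.suppIn supportSnd supportSnd_map_subset 𝒰)) := by
    refine homOfLe_sup_suppIn_supportSnd W _ _ (fun T ↦ generalizedHorn ({k}ᶜ \ T)) ?_ ?_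
    · exact fun _ ↦ mem_diagonalHorn_iff_fst_mem
    · intro T hT t
      rw [hW]
      refine (generalizedHorn_ι_mem_of_initial_vertex (boxTrivial p) ?_ ?_ _
        (k := k) (w := Fin.last n) ?_ ?_ hk).boxUnion_ι _
      · intro _ _ _ f g _ _
        exact boxTrivial_of_precomp hp.horizontalReedyLeftFibration f g
      · exact boxTrivial_initial_vertex hp
      · simp
      · exact Finset.mem_sdiff.2 ⟨by simpa using hk.ne', hT⟩
  have h₂ := homOfLe_sup_suppIn_supportFst W (diagonalHorn {k}ᶜ ⊔
      Subfunctor.suppIn supportSnd supportSnd_map_subset 𝒰) ⊤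
    (fun S ↦ generalizedHorn (insert (Fin.last n) ({k}ᶜ \ S))) (by
      intro a x
      refine (or_congr_left (mem_diagonalHorn_iff_snd_mem x)).trans ?_
      change ¬ _ ∨ _ ∉ support x.2 ↔ ¬ _
      rw [Finset.insert_subset_iff, ← not_and_or, and_comm]) (by
      intro S _ s
      rw [hW]
      apply hasLiftingProperty_boxUnion_ι hp.horizontalReedyLeftFibration
      apply leftAnodyneMaps_generalizedHorn_ι _ (k := k) (w := Fin.last n)
      · simpa using hk.ne
      · exact Finset.mem_insert_self _ _
      · exact hk)
  exact ι_mem_of_eq_top W (le_sup_left.trans le_sup_left) (sup_suppIn_top _ _ _)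
    (W.comp_mem _ _ h₁ h₂)

lemma trivialKanFibrations_diagonal_map
    (hp : ∀ ⦃A B : SSet.{u}⦄ (i : A ⟶ B) [Mono i], boxTrivial p i) :
    trivialKanFibrations (diagonal.map p) := by
  rintro _ _ _ ⟨n⟩
  rw [← generalizedHorn_univ]
  apply hasLiftingProperty_diagonal_map
  let W : MorphismProperty BiSSet.{u} := (MorphismProperty.ofHoms fun _ : Unit ↦ p).llp
  have hW {A B : BiSSet.{u}} (i : A ⟶ B) : W i ↔ HasLiftingProperty i p :=
    ⟨fun h ↦ h _ ⟨()⟩, by rintro h _ _ _ ⟨⟩; exact h⟩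
  rw [← hW]
  refine ι_mem_of_eq_top W _ (sup_suppIn_top _ _ _)
    (homOfLe_sup_suppIn_supportSnd W _ ⊤ (fun T ↦ generalizedHorn (Finset.univ \ T)) ?_ ?_)
  · exact fun _ ↦ mem_diagonalHorn_iff_fst_mem
  · intro T _ t
    rw [hW]
    have : Mono (generalizedHorn.{u} (Finset.univ \ T)).ι := inferInstanceAs (Mono (Subfunctor.ι _))
    exact (hp (generalizedHorn _).ι).boxUnion_ι _

end BiSSet

namespace BiSSet

open MorphismProperty Limits SSet SSet.stdSimplex MonoidalCategory

/-! ### The small object argument for bisimplicial sets -/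

attribute [local instance] Cardinal.fact_isRegular_aleph0 Cardinal.orderBotAleph0OrdToType

/-- Maps `K □ L ⟶ X` are maps from `L` to `homRows K X`, and `homRows K` preserves filtered colimits
when `K` is finitely presentable. -/
lemma isFinitelyPresentable_box (K L : SSet.{u}) [IsFinitelyPresentable.{u} K]
    [IsFinitelyPresentable.{u} L] : IsFinitelyPresentable.{u} (box K L) := by
  let e : coyoneda.obj (op (box K L)) ≅ homRows.obj (op K) ⋙ coyoneda.obj (op L) :=
    NatIso.ofComponents (fun X ↦ (boxHomRowsEquiv K L X).toIso) (fun _ ↦ rfl)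
  have : (homRows.obj (op K)).IsCardinalAccessible Cardinal.aleph0.{u} := by
    constructor
    intro J _ _
    refine ⟨fun {F} ↦ ?_⟩
    have := preservesColimitsOfShape_of_isCardinalPresentable K Cardinal.aleph0.{u} J
    apply preservesColimit_of_evaluation
    intro n
    have h : PreservesColimitsOfShape J (rows ⋙ (evaluation _ _).obj n ⋙ coyoneda.obj (op K)) := by
      have : PreservesColimitsOfShape J (rows.{u} ⋙ (evaluation _ _).obj n) :=
        inferInstanceAs (PreservesColimitsOfShape J
          ((Functor.whiskeringLeft _ _ (Type u)).obj (Prod.sectL SimplexCategoryᵒᵖ n)))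
      exact comp_preservesColimitsOfShape (rows.{u} ⋙ (evaluation _ _).obj n) (coyoneda.obj (op K))
    exact h.preservesColimit
  exact Functor.isCardinalAccessible_of_natIso e.symm _

lemma isFinitelyPresentable_boxUnion {K L : SSet.{u}} (A : K.Subcomplex) (B : L.Subcomplex)
    [IsFinitelyPresentable.{u} K] [IsFinitelyPresentable.{u} L]
    [IsFinitelyPresentable.{u} (A : SSet.{u})] [IsFinitelyPresentable.{u} (B : SSet.{u})] :
    IsFinitelyPresentable.{u} (boxUnion A B).toFunctor := by
  have h₁ := isFinitelyPresentable_box (A : SSet.{u}) (B : SSet.{u})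
  have h₂ := isFinitelyPresentable_box (A : SSet.{u}) L
  have h₃ := isFinitelyPresentable_box K (B : SSet.{u})
  have (k : WalkingSpan) : IsCardinalPresentable ((span ((boxFunctor.map A.ι).app (B : SSet.{u}))
      ((boxFunctor.obj (A : SSet.{u})).map B.ι)).obj k) Cardinal.aleph0.{u} := by
    obtain _ | _ | _ := k
    · exact h₁
    · exact h₃
    · exact h₂
  exact isCardinalPresentable_of_isColimit _ (boxUnionSq A B).isPushout.isColimit
    Cardinal.aleph0.{u} (hasCardinalLT_of_finite _ _ le_rfl)

lemma horizontalLeftHornInclusions_eq_iSup : horizontalLeftHornInclusions.{u} =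
    ⨆ a : ℕ × ℕ, .ofHoms (fun k : {k : Fin (a.2 + 2) // k < Fin.last (a.2 + 1)} ↦
      (boxUnion.{u} ∂Δ[a.1] Λ[a.2 + 1, k.1]).ι) := by
  ext X Y f
  simp only [iSup_iff]
  refine ⟨fun h ↦ ?_, fun h ↦ ?_⟩
  · obtain @⟨m, n, k, hn, hk⟩ := h
    obtain _ | n := n
    · lia
    · exact ⟨(m, n), ⟨(⟨k, hk⟩ : {k : Fin (n + 2) // k < Fin.last (n + 1)})⟩⟩
  · obtain ⟨n, ⟨k, hk⟩⟩ := h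
    exact .intro _ k (by lia) hk

instance : MorphismProperty.IsSmall.{u} horizontalLeftHornInclusions.{u} := by
  rw [horizontalLeftHornInclusions_eq_iSup]
  have (a : ℕ × ℕ) : MorphismProperty.IsSmall.{u} (MorphismProperty.ofHoms.{u}
      fun k : {k : Fin (a.2 + 2) // k < Fin.last (a.2 + 1)} ↦
        (boxUnion.{u} ∂Δ[a.1] Λ[a.2 + 1, k.1]).ι) :=
    isSmall_ofHoms ..
  exact isSmall_iSup _

instance : IsCardinalForSmallObjectArgument horizontalLeftHornInclusions.{u}
    Cardinal.aleph0.{u} where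
  preservesColimit {A B X Y} i hi f hf := by
    have : IsFinitelyPresentable.{u} A := by
      obtain ⟨_, _, _, _⟩ := hi
      exact isFinitelyPresentable_boxUnion _ _
    infer_instance

instance : HasSmallObjectArgument.{u} horizontalLeftHornInclusions.{u} where
  exists_cardinal := ⟨.aleph0, inferInstance, inferInstance, inferInstance⟩

/-! ### Columns and diagonals of maps lifting against horizontal Reedy left fibrations -/

/-- The restriction of a bisimplicial set along `(Ψ, 𝟭)`. This is the diagonal if `Ψ` is the
identity functor, and a column if `Ψ` is a constant functor. -/
def restriction (Ψ : SimplexCategoryᵒᵖ ⥤ SimplexCategoryᵒᵖ) : BiSSet.{u} ⥤ SSet.{u} :=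
  (Functor.whiskeringLeft _ _ _).obj (Functor.prod' Ψ (𝟭 _))

variable (Ψ : SimplexCategoryᵒᵖ ⥤ SimplexCategoryᵒᵖ)

lemma leftAnodyneMaps_restriction_map_boxUnion_ι {K L : SSet.{u}} (A : K.Subcomplex)
    {B : L.Subcomplex} (hB : leftAnodyneMaps B.ι) :
    leftAnodyneMaps ((restriction Ψ).map (boxUnion A B).ι) := by
  let K' : SSet.{u} := Ψ ⋙ K
  let A' : K'.Subcomplex := { obj n := A.obj (Ψ.obj n), map f := A.map (Ψ.map f) }
  have : Mono A'.ι := inferInstanceAs (Mono (Subfunctor.ι _))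
  have h := leftAnodyneMaps_pushoutObjObjι (Subcomplex.unionProd.pushoutObjObj A' B) hB
  rw [Subcomplex.unionProd.pushoutObjObj_ι] at h
  have hmem {n : SimplexCategoryᵒᵖ} (x : (box K L).obj (Ψ.obj n, n)) :
      (show (K' ⊗ L).obj n from x) ∈ (A'.unionProd B).obj n ↔
        x ∈ (boxUnion A B).obj (Ψ.obj n, n) := by
    refine (Subcomplex.mem_unionProd_iff ..).trans ?_
    change _ ↔ (_ ∧ True) ∨ (True ∧ _)
    rw [and_true, true_and]
    exact or_comm
  let e : (A'.unionProd B : SSet.{u}) ≅ (restriction Ψ).obj (boxUnion A B).toFunctor :=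
    NatIso.ofComponents (fun n ↦ Equiv.toIso
      { toFun x := ⟨x.1, (hmem x.1).1 x.2⟩
        invFun x := ⟨x.1, (hmem x.1).2 x.2⟩
        left_inv _ := rfl
        right_inv _ := rfl }) (fun _ ↦ rfl)
  let e' : (K' ⊗ L : SSet.{u}) ≅ (restriction Ψ).obj (box K L) := Iso.refl _
  exact (leftAnodyneMaps.arrow_mk_iso_iff (CategoryTheory.Arrow.isoMk
    (f := CategoryTheory.Arrow.mk (A'.unionProd B).ι)
    (g := CategoryTheory.Arrow.mk ((restriction Ψ).map (boxUnion A B).ι)) e e' rfl)).1 h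

/-- Restriction functors are left adjoints, so that it suffices to consider the generators. -/
lemma leftAnodyneMaps_restriction_map {X Y : BiSSet.{u}} {i : X ⟶ Y}
    (hi : horizontalLeftHornInclusions.rlp.llp i) : leftAnodyneMaps ((restriction Ψ).map i) := by
  let adj := (Functor.prod' Ψ (𝟭 SimplexCategoryᵒᵖ)).ranAdjunction (Type u)
  rw [leftAnodyneMaps_eq_llp_rlp]
  intro E B q hq
  refine (adj.hasLiftingProperty_iff i q).2 (hi _ ?_)
  rintro _ _ _ ⟨m, k, hn, hk⟩
  rw [← leftFibrations_eq_rlp] at hq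
  exact (adj.hasLiftingProperty_iff _ q).1 (hq _
    (leftAnodyneMaps_restriction_map_boxUnion_ι Ψ _ (leftAnodyneMaps_horn_ι k hn hk)))

/-! ### Column-wise right cofinal maps -/

variable {X Y : BiSSet.{u}} {p : X ⟶ Y}

lemma isIso_homRows_map_of_isEmpty (p : X ⟶ Y) (K : SSet.{u}) (hK : ∀ n, IsEmpty (K.obj n)) :
    IsIso ((homRows.obj (op K)).map p) := by
  have (n : SimplexCategoryᵒᵖ) : IsIso (((homRows.obj (op K)).map p).app n) := by
    rw [isIso_iff_bijective]
    have h (Z : SSet.{u}) : Unique (K ⟶ Z) :=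
      { default :=
          { app n := ↾fun x ↦ (hK n).elim x
            naturality n _ _ := by ext x; exact (hK n).elim x }
        uniq f := by ext n x; exact (hK n).elim x }
    have h₁ := h ((rows.obj X).obj n)
    have h₂ := h ((rows.obj Y).obj n)
    exact ⟨fun _ _ _ ↦ h₁.instSubsingleton.elim _ _,
      fun y ↦ ⟨h₁.default, h₂.instSubsingleton.elim _ _⟩⟩
  exact NatIso.isIso_of_isIso_app _

/-- The columns of `p` are the pullback-homs of the inclusions `∅ ⟶ Δ[m]` and `p`. -/
lemma exists_arrow_iso_column_map (p : X ⟶ Y) (m : ℕ) :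
    Nonempty (CategoryTheory.Arrow.mk (homRowsSq p (⊥ : (Δ[m] : SSet.{u}).Subcomplex).ι).π ≅
      CategoryTheory.Arrow.mk ((column m).map p)) := by
  let sq := homRowsSq p (⊥ : (Δ[m] : SSet.{u}).Subcomplex).ι
  have := isIso_homRows_map_of_isEmpty p ((⊥ : (Δ[m] : SSet.{u}).Subcomplex) : SSet.{u})
    (fun _ ↦ ⟨fun x ↦ x.2⟩)
  have : IsIso sq.snd := sq.isPullback.isIso_snd_of_isIso
  refine ⟨CategoryTheory.Arrow.isoMk (homRowsStdSimplexIso m X)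
    (asIso sq.snd ≪≫ homRowsStdSimplexIso m Y) ?_⟩
  refine (homRowsStdSimplexIso_naturality m p).symm.trans ?_
  exact (congr_arg (· ≫ _) sq.π_snd).symm.trans (Category.assoc ..)

lemma leftFibrations_column_map (hp : horizontalReedyLeftFibrations p) (m : ℕ) :
    leftFibrations ((column m).map p) := by
  obtain ⟨e⟩ := exists_arrow_iso_column_map p m
  have : Mono (⊥ : (Δ[m] : SSet.{u}).Subcomplex).ι := inferInstanceAs (Mono (Subfunctor.ι _))
  exact (MorphismProperty.arrow_mk_iso_iff leftAnodyneMaps.rlp e).1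
    (leftFibrations_homRowsSq_π hp _)

/-- If the columns of `p` are trivial Kan fibrations, then `∅ ⟶ Δ[n]` belongs to `boxTrivial p`. By
induction, so does `∅ ⟶ ∂Δ[n]`, as `∂Δ[n]` is obtained by attaching simplices of smaller dimension;
one concludes by right cancellation. -/
lemma boxTrivial_boundary_ι (hp : horizontalReedyLeftFibrations p)
    (hp' : ∀ m, trivialKanFibrations ((column m).map p)) (n : ℕ) :
    boxTrivial p (∂Δ[n] : Subcomplex.{u} _).ι := by
  induction n using Nat.strong_induction_on with
  | h n hn =>
    let 𝒰 : LowerSet (Finset (Fin (n + 1))) :=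
      ⟨{T | T ≠ Finset.univ}, fun S T h hS hT ↦ hS (Finset.univ_subset_iff.1 (hT ▸ h))⟩
    have h₁ : (⊥ : (Δ[n] : SSet.{u}).Subcomplex) ⊔ Subfunctor.suppIn support support_map_subset 𝒰 =
        ∂Δ[n] := by
      rw [bot_sup_eq]
      ext a x
      exact (mem_boundary_iff_support_ne_univ x).symm
    have h₂ := Subfunctor.homOfLe_sup_suppIn (boxTrivial p) support support_map_subset
      support_nonempty (⊥ : (Δ[n] : SSet.{u}).Subcomplex) 𝒰 (by
        intro T hT hT'
        obtain ⟨t, e, he, rfl⟩ := exists_face T hT'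
        refine ⟨_, stdSimplex.{u}.map e, mono_map e he, ?_, ?_⟩
        · ext a x
          exact mem_range_map_iff e he x
        · refine (congr_arg (fun D : (Δ[t] : SSet.{u}).Subcomplex ↦ boxTrivial p D.ι) ?_).mpr
            (hn t ?_)
          · rw [bot_sup_eq]
            ext a x
            exact support_map_app_ssubset_iff he x
          · have := Finset.card_lt_card (Finset.ssubset_univ_iff.2 hT)
            rw [Finset.card_image_of_injective _ he, Finset.card_univ, Finset.card_univ,
              Fintype.card_fin, Fintype.card_fin] at this
            exact Nat.lt_of_succ_lt_succ this)
    rw [← h₁]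
    have : Mono ((⊥ : (Δ[n] : SSet.{u}).Subcomplex) ⊔
        Subfunctor.suppIn support support_map_subset 𝒰).ι := inferInstanceAs (Mono (Subfunctor.ι _))
    refine boxTrivial_of_precomp hp _ _ h₂ ?_
    obtain ⟨e⟩ := exists_arrow_iso_column_map p n
    exact (MorphismProperty.arrow_mk_iso_iff modelCategoryQuillen.I.rlp e).2 (hp' n)

lemma boxTrivial_of_mono (hp : horizontalReedyLeftFibrations p)
    (hp' : ∀ m, trivialKanFibrations ((column m).map p)) {A B : SSet.{u}} (i : A ⟶ B) [Mono i] :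
    boxTrivial p i := by
  suffices monomorphisms SSet.{u} ≤ boxTrivial p from this _ (.infer_property _)
  rw [boxTrivial_eq_llp, le_llp_iff_le_rlp, ← trivialKanFibrations_eq_rlp, trivialKanFibrations,
    ← le_llp_iff_le_rlp, ← boxTrivial_eq_llp]
  rintro _ _ _ ⟨n⟩
  exact boxTrivial_boundary_ι hp hp' n

/-- The diagonal of a column-wise right cofinal map `f` is right cofinal: if `f` is factored as a
map `i` which lifts against the horizontal Reedy left fibrations followed by such a fibration `p`,
then `di` is left anodyne and `dp` is a trivial Kan fibration. -/
lemma rightCofinalMaps_diagonal_map {f : X ⟶ Y} (hf : IsColumnwiseRightCofinal f) :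
    rightCofinalMaps (diagonal.map f) := by
  let φ := MorphismProperty.factorizationData horizontalLeftHornInclusions.rlp.llp
    horizontalLeftHornInclusions.rlp f
  have h₁ (m : ℕ) : leftAnodyneMaps ((column m).map φ.i) :=
    leftAnodyneMaps_restriction_map ((Functor.const _).obj (op ⦋m⦌)) φ.hi
  have h₂ : leftAnodyneMaps (diagonal.map φ.i) := leftAnodyneMaps_restriction_map (𝟭 _) φ.hi
  have h₃ (m : ℕ) : trivialKanFibrations ((column m).map φ.p) := by
    refine trivialKanFibrations_of_rightCofinalMaps_comp (h₁ m)
      (leftFibrations_column_map φ.hp m) ?_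
    rw [← Functor.map_comp, φ.fac]
    exact hf m
  refine ⟨_, diagonal.map φ.i, diagonal.map φ.p, h₂,
    trivialKanFibrations_diagonal_map fun _ _ i _ ↦ boxTrivial_of_mono φ.hp h₃ i, ?_⟩
  rw [← Functor.map_comp, φ.fac]

end BiSSet

theorem mainTheorem11 :
    (∀ {X Y : BiSSet.{u}} (p : X ⟶ Y),
      BiSSet.IsStrongHorizontalReedyLeftFibration p →
        SSet.leftFibrations (BiSSet.diagonal.map p)) ∧
    (∀ {X Y : BiSSet.{u}} (f : X ⟶ Y),
      BiSSet.IsColumnwiseRightCofinal f →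
        SSet.rightCofinalMaps (BiSSet.diagonal.map f)) :=
  ⟨fun _ hp ↦ BiSSet.leftFibrations_diagonal_map hp,
    fun _ hf ↦ BiSSet.rightCofinalMaps_diagonal_map hf⟩
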